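/- Let $\Lambda\subset(0,\infty)$ be a nonempty, at most countable set. Let $\mathbb U_\Lambda$ be the ultrametric Urysohn space with spectrum $\Lambda$, i.e. the space of all functions $\omega:\Lambda\to\mathbb Z$ such that for every $\varepsilon>0$ only finitely many $\lambda\in\Lambda$ with $\lambda\ge\varepsilon$ satisfy $\omega(\lambda)\ne0$, with the distance $d(\omega,\omega')=\max\{\lambda\in\Lambda:\omega(\lambda)\neq\omega'(\lambda)\}$ for $\omega\ne\omega'$. Let $\mathbb I_\Lambda$ be the group of all bijective isometries of $\mathbb U_\Lambda$, with the topology of pointwise convergence. A unitary representation of a topological group is a strongly continuous one in a separable complex Hilbert space. It weakly contains the trivial representation if, on every compact subset of the group, the constant function $1$ can be uniformly approximated by finite sums of functions $g\mapsto\langle\rho(g)\eta,\eta\rangle$. A topological group has Kazhdan property (T) if every unitary representation that weakly contains the trivial representation has a nonzero invariant vector. (1) The group $\mathbb I_\Lambda$ has Kazhdan property (T) if and only if $\Lambda$ has a maximal element. (2) If $\Lambda$ has no maximal element, then $\mathbb I_\Lambda$ has a continuous action by affine isometries on a separable real Hilbert space $H$ without fixed points. More precisely, there are an increasing bijection $\varkappa:[0,\sup\Lambda)\to[0,\infty)$,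 which can be taken to be the identity if $\Lambda$ is unbounded, a map $\psi:\mathbb U_\Lambda\to H$ with $\|\psi(x)-\psi(y)\|=\varkappa(d(x,y))$ for all $x,y$ whose image lies in no proper closed affine subspace, and a continuous action $R$ of $\mathbb I_\Lambda$ on $H$ by affine isometries such that $R(g)\psi(x)=\psi(gx)$ for all $g\in\mathbb I_\Lambda$, $x\in\mathbb U_\Lambda$, and no point of $H$ is fixed by all $R(g)$. In particular, for unbounded $\Lambda$ the map $\psi$ is an isometric embedding of $\mathbb U_\Lambda$ in $H$. -/

import Mathlib

/-- The Urysohn ultrametric space `𝕌_Λ` with spectrum `Λ ⊆ (0, ∞)`: the space of functions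
`ω : Λ → ℤ` whose support is finite or a sequence converging to `0`, that is, such that for
every `ε > 0` only finitely many `l ≥ ε` in `Λ` satisfy `ω l ≠ 0`. -/
structure UrysohnSpace (Λ : Set (Set.Ioi (0 : ℝ))) where
  /-- the underlying function -/
  toFun : Λ → ℤ
  /-- the support accumulates at most at `0` -/
  finite_support : ∀ ε : ℝ, 0 < ε → {l : Λ | ε ≤ ((l : Set.Ioi (0 : ℝ)) : ℝ) ∧ toFun l ≠ 0}.Finite

namespace UrysohnSpace

variable {Λ : Set (Set.Ioi (0 : ℝ))}

/-- The set of the numbers `l ∈ Λ` at which two functions differ. -/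
def diffSet (x y : UrysohnSpace Λ) : Set ℝ :=
  {t : ℝ | ∃ l : Λ, x.toFun l ≠ y.toFun l ∧ ((l : Set.Ioi (0 : ℝ)) : ℝ) = t}

/-- The distance of `x` and `y` is the largest `l ∈ Λ` with `x l ≠ y l`, and `0` if `x = y`
(`isGreatest_dist` shows that the maximum is attained). -/
noncomputable instance : Dist (UrysohnSpace Λ) := ⟨fun x y => sSup (diffSet x y)⟩

theorem dist_def (x y : UrysohnSpace Λ) : dist x y = sSup (diffSet x y) := rfl

theorem ext_fun {x y : UrysohnSpace Λ} (h : ∀ l, x.toFun l = y.toFun l) : x = y := by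
  cases x; cases y; congr; exact funext h

theorem finite_diff (x y : UrysohnSpace Λ) {ε : ℝ} (hε : 0 < ε) :
    (diffSet x y ∩ Set.Ici ε).Finite := by
  refine (((x.finite_support ε hε).union (y.finite_support ε hε)).image
    (fun l : Λ => ((l : Set.Ioi (0 : ℝ)) : ℝ))).subset ?_
  rintro t ⟨⟨l, hl, rfl⟩, hle⟩
  refine ⟨l, ?_, rfl⟩
  by_cases hx : x.toFun l = 0
  · exact Or.inr ⟨hle, fun hy => hl (hx.trans hy.symm)⟩
  · exact Or.inl ⟨hle, hx⟩

theorem diffSet_nonempty {x y : UrysohnSpace Λ} (h : x ≠ y) : (diffSet x y).Nonempty := by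
  by_contra hne
  rw [Set.not_nonempty_iff_eq_empty] at hne
  refine h (ext_fun fun l => ?_)
  by_contra hl
  have : ((l : Set.Ioi (0 : ℝ)) : ℝ) ∈ diffSet x y := ⟨l, hl, rfl⟩
  rw [hne] at this
  exact this

theorem isGreatest_dist {x y : UrysohnSpace Λ} (h : x ≠ y) :
    IsGreatest (diffSet x y) (dist x y) := by
  obtain ⟨t, ht⟩ := diffSet_nonempty h
  have ht0 : 0 < t := by
    obtain ⟨l, -, rfl⟩ := ht
    exact l.1.2
  obtain ⟨m, hm, hmax⟩ := Set.exists_max_image (diffSet x y ∩ Set.Ici t) id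
    (finite_diff x y ht0) ⟨t, ht, le_refl t⟩
  have hg : IsGreatest (diffSet x y) m := by
    refine ⟨hm.1, fun s hs => ?_⟩
    rcases le_total t s with hts | hst
    · exact hmax s ⟨hs, hts⟩
    · exact hst.trans hm.2
  rw [dist_def, hg.csSup_eq]
  exact hg

theorem dist_self' (x : UrysohnSpace Λ) : dist x x = 0 := by
  have : diffSet x x = ∅ := by
    ext t
    simp [diffSet]
  rw [dist_def, this, Real.sSup_empty]

theorem diffSet_comm (x y : UrysohnSpace Λ) : diffSet x y = diffSet y x := by
  ext t
  simp only [diffSet, ne_comm]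

theorem dist_pos' {x y : UrysohnSpace Λ} (h : x ≠ y) : 0 < dist x y := by
  obtain ⟨l, -, hl⟩ := (isGreatest_dist h).1
  rw [← hl]
  exact l.1.2

theorem dist_nonneg' (x y : UrysohnSpace Λ) : 0 ≤ dist x y := by
  by_cases h : x = y
  · rw [h, dist_self']
  · exact (dist_pos' h).le

theorem le_dist {x y : UrysohnSpace Λ} {l : Λ} (h : x.toFun l ≠ y.toFun l) :
    ((l : Set.Ioi (0 : ℝ)) : ℝ) ≤ dist x y := by
  have hxy : x ≠ y := fun e => h (by rw [e])
  exact (isGreatest_dist hxy).2 ⟨l, h, rfl⟩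

theorem dist_triangle_max' (x y z : UrysohnSpace Λ) :
    dist x z ≤ max (dist x y) (dist y z) := by
  by_cases h : x = z
  · rw [h, dist_self']
    exact le_max_of_le_left (dist_nonneg' _ _)
  · obtain ⟨l, hl, e⟩ := (isGreatest_dist h).1
    rw [← e]
    by_cases hxy : x.toFun l = y.toFun l
    · exact le_max_of_le_right (le_dist fun hyz => hl (hxy.trans hyz))
    · exact le_max_of_le_left (le_dist hxy)

noncomputable instance : MetricSpace (UrysohnSpace Λ) where
  dist_self := dist_self'
  dist_comm x y := by rw [dist_def, dist_def, diffSet_comm]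
  dist_triangle x y z := (dist_triangle_max' x y z).trans
    (max_le_add_of_nonneg (dist_nonneg' _ _) (dist_nonneg' _ _))
  eq_of_dist_eq_zero {x y} h := by
    by_contra hne
    exact (dist_pos' hne).ne' h

instance : IsUltrametricDist (UrysohnSpace Λ) := ⟨dist_triangle_max'⟩

end UrysohnSpace

/-- The group `𝕀_Λ` of all (bijective) isometries of the Urysohn space `𝕌_Λ`. -/
abbrev UrysohnIsom (Λ : Set (Set.Ioi (0 : ℝ))) : Type := UrysohnSpace Λ ≃ᵢ UrysohnSpace Λ

/-- The topology of pointwise convergence on `𝕀_Λ`. -/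
noncomputable instance (Λ : Set (Set.Ioi (0 : ℝ))) : TopologicalSpace (UrysohnIsom Λ) :=
  TopologicalSpace.induced (fun (g : UrysohnIsom Λ) (x : UrysohnSpace Λ) => g x) inferInstance

instance (Λ : Set (Set.Ioi (0 : ℝ))) : IsTopologicalGroup (UrysohnIsom Λ) := by
  have hev : ∀ x : UrysohnSpace Λ, Continuous fun g : UrysohnIsom Λ => g x := fun x =>
    (continuous_apply x).comp continuous_induced_dom
  refine { continuous_mul := ?_, continuous_inv := ?_ }
  · refine continuous_induced_rng.2 (continuous_pi fun x => ?_)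
    refine continuous_iff_continuousAt.2 fun p => ?_
    refine tendsto_iff_dist_tendsto_zero.2 ?_
    have h1 : Continuous fun q : UrysohnIsom Λ × UrysohnIsom Λ =>
        dist (q.2 x) (p.2 x) + dist (q.1 (p.2 x)) (p.1 (p.2 x)) :=
      (((hev x).comp continuous_snd).dist continuous_const).add
        (((hev (p.2 x)).comp continuous_fst).dist continuous_const)
    have h2 := h1.tendsto p
    simp only [dist_self, add_zero] at h2
    refine squeeze_zero (fun _ => dist_nonneg) (fun q => ?_) h2
    calc dist (q.1 (q.2 x)) (p.1 (p.2 x))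
        ≤ dist (q.1 (q.2 x)) (q.1 (p.2 x)) + dist (q.1 (p.2 x)) (p.1 (p.2 x)) :=
          dist_triangle _ _ _
      _ = _ := by rw [q.1.isometry.dist_eq]
  · refine continuous_induced_rng.2 (continuous_pi fun x => ?_)
    refine continuous_iff_continuousAt.2 fun p => ?_
    refine tendsto_iff_dist_tendsto_zero.2 ?_
    have h1 : Continuous fun q : UrysohnIsom Λ => dist x (q (p.symm x)) :=
      continuous_const.dist (hev (p.symm x))
    have h2 := h1.tendsto p
    simp only [IsometryEquiv.apply_symm_apply, dist_self] at h2
    refine h2.congr fun q => ?_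
    calc dist x (q (p.symm x)) = dist (q (q.symm x)) (q (p.symm x)) := by
          rw [IsometryEquiv.apply_symm_apply]
      _ = dist (q.symm x) (p.symm x) := q.isometry.dist_eq _ _

/-- A unitary representation of a topological group: a homomorphism to the group of unitary
operators of a complex Hilbert space, continuous for the strong operator topology. -/
structure UnitaryRep (G : Type*) [Group G] [TopologicalSpace G]
    (H : Type*) [NormedAddCommGroup H] [InnerProductSpace ℂ H] where
  /-- the homomorphism to the unitary group -/
  toHom : G →* (H ≃ₗᵢ[ℂ] H)
  /-- strong continuity -/
  continuous_apply : ∀ v : H, Continuous fun g : G => toHom g v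

namespace UnitaryRep

variable {G : Type*} [Group G] [TopologicalSpace G]
  {H : Type*} [NormedAddCommGroup H] [InnerProductSpace ℂ H]
  {K : Type*} [NormedAddCommGroup K] [InnerProductSpace ℂ K]

/-- The one-dimensional trivial representation. -/
noncomputable def trivial (G : Type*) [Group G] [TopologicalSpace G] : UnitaryRep G ℂ where
  toHom := 1
  continuous_apply _ := continuous_const

/-- `ρ` weakly contains `π`: every function of positive type `g ↦ ⟨π(g)ξ, ξ⟩` associated with
`π` is a limit, uniformly on compact subsets of `G`, of finite sums of functions of positive
type associated with `ρ`. -/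
def WeaklyContains (ρ : UnitaryRep G H) (π : UnitaryRep G K) : Prop :=
  ∀ (ξ : K) (Q : Set G), IsCompact Q → ∀ ε : ℝ, 0 < ε →
    ∃ (n : ℕ) (η : Fin n → H), ∀ g ∈ Q,
      ‖inner ℂ ξ (π.toHom g ξ) - ∑ i, inner ℂ (η i) (ρ.toHom g (η i))‖ < ε

/-- `ρ` contains the trivial representation as a subrepresentation. -/
def ContainsTrivial (ρ : UnitaryRep G H) : Prop :=
  ∃ v : H, v ≠ 0 ∧ ∀ g : G, ρ.toHom g v = v

end UnitaryRep

/-- Kazhdan's property (T): every unitary representation of `G` in a separable Hilbert space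
that weakly contains the trivial representation contains it as a subrepresentation.
(Every separable Hilbert space is isometric to one in `Type`.) -/
def HasPropertyT (G : Type*) [Group G] [TopologicalSpace G] : Prop :=
  ∀ (H : Type) [NormedAddCommGroup H] [InnerProductSpace ℂ H] [CompleteSpace H]
    [TopologicalSpace.SeparableSpace H] (ρ : UnitaryRep G H),
    ρ.WeaklyContains (UnitaryRep.trivial G) → ρ.ContainsTrivial

/-- An affine isometric action of a topological group on a real Hilbert space, continuous in the
group variable. -/
structure AffineIsometricAction (G : Type*) [Group G] [TopologicalSpace G]
    (H : Type*) [NormedAddCommGroup H] [InnerProductSpace ℝ H] where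
  /-- the homomorphism to the group of affine isometries -/
  toHom : G →* (H ≃ᵃⁱ[ℝ] H)
  /-- continuity of the orbit maps -/
  continuous_apply : ∀ v : H, Continuous fun g : G => toHom g v

/-! Suppose that `Λ` has a maximum `m`. The points with a given `m`-th coordinate form a maximal
proper ball, and permuting this coordinate embeds `Sym(ℤ)` in the group. A vector fixed by this
subgroup is fixed by the whole group (`fixed_of_permAt_fixed`), because an isometry supported on
finitely many of these balls can be pushed to the identity by conjugating with shifts. What remains
is a spectral gap for `Sym(X)`, where `X` is the free group of rank two and the four letters act by
left translation. Without invariant vectors, vectors fixed by the stabilizers of disjoint finite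
sets are orthogonal (`inner_eq_zero_of_disjoint_fixed`). Matrix coefficients of powers of the sum of
the four operators are therefore controlled by random walk paths between finite sets. The
superharmonic function `2 ^ (-|x|)` bounds their growth rate by `7/2 < 4`
(`norm_sum_letterPerm_le`).

Suppose that `Λ` has no maximum. A compact set of isometries preserves some ball, while every orbit
of balls is infinite. So the representation in `ℓ²` of the set of balls weakly contains the trivial
one but has no invariant vector (`not_hasPropertyT`). For the affine action, an ultrametric is of
negative type: it is an integral over `t` of indicators of `d > t`, and each `d ≤ t` is an
equivalence relation (`sum_ultrametric_kernel_nonneg`). Since `κ(d)²` is again an ultrametric, its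
square root `κ(d)` embeds in a Hilbert space, and isometries extend affinely. The group is
transitive, so a fixed point would put the unbounded image of `ψ` on a sphere. -/

open Filter Topology

/-! ### Operators determined by Gram matrices. -/

section GramFamilies

variable {𝕜 H X G : Type*} [RCLike 𝕜] [NormedAddCommGroup H] [InnerProductSpace 𝕜 H]

theorem hom_mul_apply [Group G] (π : G →* (H ≃ₗᵢ[𝕜] H)) (a b : G) (v : H) :
    π (a * b) v = π a (π b v) := by
  rw [map_mul]
  rfl

/-- The norm of a linear combination depends only on the Gram matrix of the family. -/
theorem norm_linearCombination_eq_of_inner_eq {u w : X → H}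
    (h : ∀ x y, inner 𝕜 (w x) (w y) = inner 𝕜 (u x) (u y)) (f : X →₀ 𝕜) :
    ‖Finsupp.linearCombination 𝕜 w f‖ = ‖Finsupp.linearCombination 𝕜 u f‖ := by
  have key : inner 𝕜 (Finsupp.linearCombination 𝕜 w f) (Finsupp.linearCombination 𝕜 w f) =
      inner 𝕜 (Finsupp.linearCombination 𝕜 u f) (Finsupp.linearCombination 𝕜 u f) := by
    simp only [Finsupp.linearCombination_apply, Finsupp.sum_inner, Finsupp.inner_sum,
      inner_smul_left, inner_smul_right, h]
  rw [inner_self_eq_norm_sq_to_K, inner_self_eq_norm_sq_to_K] at key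
  have key' : ‖Finsupp.linearCombination 𝕜 w f‖ ^ 2 = ‖Finsupp.linearCombination 𝕜 u f‖ ^ 2 := by
    exact_mod_cast key
  exact (pow_left_inj₀ (norm_nonneg _) (norm_nonneg _) two_ne_zero).1 key'

theorem denseRange_linearCombination {u : X → H}
    (hu : Dense (Submodule.span 𝕜 (Set.range u) : Set H)) :
    DenseRange (Finsupp.linearCombination 𝕜 u) := by
  rw [← Finsupp.range_linearCombination] at hu
  exact hu

theorem LinearIsometryEquiv.ext_of_dense_span {u : X → H}
    (hu : Dense (Submodule.span 𝕜 (Set.range u) : Set H)) {S T : H ≃ₗᵢ[𝕜] H}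
    (h : ∀ x, S (u x) = T (u x)) : S = T := by
  have : (S : H →L[𝕜] H) = (T : H →L[𝕜] H) := by
    refine ContinuousLinearMap.ext_on hu ?_
    rintro _ ⟨x, rfl⟩
    exact h x
  ext v
  exact DFunLike.congr_fun this v

/-- A group acting on the index set of a total family and preserving its Gram matrix acts by
unitary operators. -/
theorem exists_unitary_hom_of_inner_eq [Group G] [CompleteSpace H] {u : X → H}
    (hu : Dense (Submodule.span 𝕜 (Set.range u) : Set H)) (σ : G →* Equiv.Perm X)
    (h : ∀ g x y, inner 𝕜 (u (σ g x)) (u (σ g y)) = inner 𝕜 (u x) (u y)) :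
    ∃ L : G →* (H ≃ₗᵢ[𝕜] H), ∀ g x, L g (u x) = u (σ g x) := by
  have hd : ∀ g, Dense (Submodule.span 𝕜 (Set.range fun x => u (σ g x)) : Set H) := by
    intro g
    have : (Set.range fun x => u (σ g x)) = Set.range u := (σ g).surjective.range_comp u
    rwa [this]
  have hex : ∀ g, ∃ T : H ≃ₗᵢ[𝕜] H, ∀ x, T (u x) = u (σ g x) := by
    intro g
    refine ⟨(LinearEquiv.refl 𝕜 (X →₀ 𝕜)).extendOfIsometry (Finsupp.linearCombination 𝕜 u)
      (Finsupp.linearCombination 𝕜 fun x => u (σ g x)) (denseRange_linearCombination hu)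
      (denseRange_linearCombination (hd g))
      (fun f => norm_linearCombination_eq_of_inner_eq (h g) f), fun x => ?_⟩
    have := LinearEquiv.extendOfIsometry_eq (LinearEquiv.refl 𝕜 (X →₀ 𝕜))
      (Finsupp.linearCombination 𝕜 u) (Finsupp.linearCombination 𝕜 fun x => u (σ g x))
      (denseRange_linearCombination hu) (denseRange_linearCombination (hd g))
      (fun f => norm_linearCombination_eq_of_inner_eq (h g) f) (Finsupp.single x 1)
    simpa using this
  choose T hT using hex
  refine ⟨MonoidHom.mk' T fun a b => ?_, hT⟩
  refine LinearIsometryEquiv.ext_of_dense_span hu fun x => ?_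
  simp [hT]

/-- Strong continuity can be checked on a total family. -/
theorem continuous_unitary_apply_of_dense [TopologicalSpace G] {u : X → H}
    (hu : Dense (Submodule.span 𝕜 (Set.range u) : Set H)) (L : G → (H ≃ₗᵢ[𝕜] H))
    (h : ∀ x, Continuous fun g => L g (u x)) (v : H) : Continuous fun g => L g v := by
  have hspan : ∀ w ∈ Submodule.span 𝕜 (Set.range u), Continuous fun g => L g w := by
    intro w hw
    induction hw using Submodule.span_induction with
    | mem w hw => obtain ⟨x, rfl⟩ := hw; exact h x
    | zero => simpa using continuous_const
    | add a b _ _ ha hb => simpa only [map_add] using Continuous.fun_add ha hb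
    | smul c a _ ha => simpa only [map_smul] using Continuous.fun_const_smul ha c
  -- Unitarity makes the approximation of `v` by `w` uniform in `g`.
  refine continuous_of_uniform_approx_of_continuous fun U hU => ?_
  obtain ⟨ε, hε, hεU⟩ := Metric.mem_uniformity_dist.1 hU
  obtain ⟨w, hw, hvw⟩ := Metric.dense_iff.1 hu v ε hε
  refine ⟨fun g => L g w, hspan w hvw, fun g => hεU ?_⟩
  rw [(L g).dist_map, dist_comm]
  exact hw

end GramFamilies

/-! ### Almost fixed vectors and growth of symmetric operators. -/

section FixedVectors

variable {H Γ : Type*} [NormedAddCommGroup H] [InnerProductSpace ℂ H] [Group Γ]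

/-- A vector that is displaced by at most `ε` by a group of unitary operators is within `ε` of a
fixed vector. -/
theorem exists_fixed_near_of_norm_sub_le [CompleteSpace H] (π : Γ →* (H ≃ₗᵢ[ℂ] H)) (K : Subgroup Γ) {v : H} {ε : ℝ}
    (hv : ∀ g ∈ K, ‖π g v - v‖ ≤ ε) : ∃ u : H, ‖u - v‖ ≤ ε ∧ ∀ g ∈ K, π g u = u := by
  let _ : InnerProductSpace ℝ H := InnerProductSpace.rclikeToReal ℂ H
  set O : Set H := (fun g => π g v) '' (K : Set Γ) with hO
  set C : Set H := closure (convexHull ℝ O) with hC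
  have hCne : C.Nonempty := ⟨v, subset_closure (subset_convexHull ℝ O ⟨1, K.one_mem, by simp⟩)⟩
  have hCconv : Convex ℝ C := (convex_convexHull ℝ O).closure
  -- The point of least norm in the closed convex hull of the orbit is unique, hence fixed by `K`.
  obtain ⟨u, huC, hu⟩ := exists_norm_eq_iInf_of_complete_convex hCne isClosed_closure.isComplete
    hCconv 0
  have hball : C ⊆ Metric.closedBall v ε := by
    refine closure_minimal (convexHull_min ?_ (convex_closedBall v ε)) Metric.isClosed_closedBall
    rintro _ ⟨g, hg, rfl⟩
    rw [Metric.mem_closedBall, dist_eq_norm]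
    exact hv g hg
  refine ⟨u, by simpa [dist_eq_norm] using hball huC, fun g hg => ?_⟩
  have hmaps : ∀ w ∈ C, π g w ∈ C := by
    intro w hw
    let T : H →ₗ[ℝ] H := ((π g).toLinearEquiv.toLinearMap).restrictScalars ℝ
    have hT : Continuous T := (π g).continuous
    have h1 : T '' convexHull ℝ O ⊆ convexHull ℝ O := by
      rw [T.image_convexHull]
      refine convexHull_mono ?_
      rintro _ ⟨_, ⟨k, hk, rfl⟩, rfl⟩
      exact ⟨g * k, K.mul_mem hg hk, by simp [T]⟩
    exact closure_mono h1 (image_closure_subset_closure_image hT ⟨w, hw, rfl⟩)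
  have hmin : ∀ w ∈ C, ‖u‖ ≤ ‖w‖ := by
    intro w hw
    have h1 : (⨅ w : C, ‖(0 : H) - w‖) ≤ ‖(0 : H) - w‖ :=
      ciInf_le ⟨0, Set.forall_mem_range.2 fun _ => norm_nonneg _⟩ (⟨w, hw⟩ : C)
    rw [← hu] at h1
    simpa using h1
  have hmid := hmin _ (hCconv.midpoint_mem (hmaps u huC) huC)
  have hpar := parallelogram_law_with_norm ℝ (π g u) u
  rw [midpoint_eq_smul_add, norm_smul] at hmid
  have hn : ‖π g u‖ = ‖u‖ := (π g).norm_map u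
  have h2 : 2 * ‖u‖ ≤ ‖π g u + u‖ := by
    norm_num at hmid
    linarith
  rw [hn] at hpar
  have h3 : ‖π g u - u‖ * ‖π g u - u‖ ≤ 0 := by
    nlinarith [norm_nonneg u, norm_nonneg (π g u + u)]
  have h4 : ‖π g u - u‖ = 0 := by nlinarith [norm_nonneg (π g u - u)]
  exact sub_eq_zero.1 (norm_eq_zero.1 h4)

/-- Log-convexity of the norms of the iterates of a symmetric operator. -/
theorem norm_iterate_symmetric_ge (T : H →L[ℂ] H)
    (hT : ∀ x y, inner ℂ (T x) y = inner ℂ x (T y)) (v : H) (n : ℕ) :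
    ‖(T ^ n) v‖ * ‖T v‖ ≤ ‖(T ^ (n + 1)) v‖ * ‖v‖ := by
  induction n with
  | zero => simp [mul_comm]
  | succ n ih =>
    have hcs : ‖(T ^ (n + 1)) v‖ ^ 2 ≤ ‖(T ^ n) v‖ * ‖(T ^ (n + 2)) v‖ := by
      have h1 : inner ℂ ((T ^ (n + 1)) v) ((T ^ (n + 1)) v) =
          inner ℂ ((T ^ n) v) ((T ^ (n + 2)) v) := by
        rw [pow_succ' T n, pow_succ' T (n + 1), pow_succ' T n]
        exact hT _ _
      have h2 := norm_inner_le_norm (𝕜 := ℂ) ((T ^ n) v) ((T ^ (n + 2)) v)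
      rw [← h1, inner_self_eq_norm_sq_to_K] at h2
      simpa using h2
    rcases (norm_nonneg ((T ^ n) v)).eq_or_lt with h0 | h0
    · have : (T ^ (n + 1)) v = 0 := by
        rw [pow_succ', mul_apply_eq_comp, norm_eq_zero.1 h0.symm, map_zero]
      rw [this]
      simp only [norm_zero, zero_mul]
      positivity
    · refine le_of_mul_le_mul_left ?_ h0
      calc ‖(T ^ n) v‖ * (‖(T ^ (n + 1)) v‖ * ‖T v‖)
          = ‖(T ^ (n + 1)) v‖ * (‖(T ^ n) v‖ * ‖T v‖) := by ring
        _ ≤ ‖(T ^ (n + 1)) v‖ * (‖(T ^ (n + 1)) v‖ * ‖v‖) := by gcongr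
        _ = ‖(T ^ (n + 1)) v‖ ^ 2 * ‖v‖ := by ring
        _ ≤ (‖(T ^ n) v‖ * ‖(T ^ (n + 2)) v‖) * ‖v‖ := by gcongr
        _ = ‖(T ^ n) v‖ * (‖(T ^ (n + 1 + 1)) v‖ * ‖v‖) := by ring

/-- A symmetric operator contracts `v` at the exponential rate at which `⟨T ^ n v, v⟩` decays. -/
theorem norm_symmetric_apply_le (T : H →L[ℂ] H)
    (hT : ∀ x y, inner ℂ (T x) y = inner ℂ x (T y)) {v : H} {C r : ℝ} (hr : 0 < r)
    (h : ∀ n : ℕ, ‖inner ℂ ((T ^ n) v) v‖ ≤ C * r ^ n) : ‖T v‖ ≤ r * ‖v‖ := by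
  rcases (norm_nonneg v).eq_or_lt with h0 | h0
  · rw [norm_eq_zero.1 h0.symm]
    simp
  by_contra! hlt
  -- By log-convexity the ratios of successive norms never fall below `‖T v‖ / ‖v‖`, so the iterates
  -- grow at least geometrically at that rate.
  have hpow : ∀ n : ℕ, ‖T v‖ ^ n * ‖v‖ ≤ ‖(T ^ n) v‖ * ‖v‖ ^ n := by
    intro n
    induction n with
    | zero => simp
    | succ n ih =>
      calc ‖T v‖ ^ (n + 1) * ‖v‖ = (‖T v‖ ^ n * ‖v‖) * ‖T v‖ := by ring
        _ ≤ (‖(T ^ n) v‖ * ‖v‖ ^ n) * ‖T v‖ := by gcongr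
        _ = (‖(T ^ n) v‖ * ‖T v‖) * ‖v‖ ^ n := by ring
        _ ≤ (‖(T ^ (n + 1)) v‖ * ‖v‖) * ‖v‖ ^ n := by
          exact mul_le_mul_of_nonneg_right (norm_iterate_symmetric_ge T hT v n) (by positivity)
        _ = _ := by ring
  have hsymm : ∀ (n : ℕ) (x y : H), inner ℂ ((T ^ n) x) y = inner ℂ x ((T ^ n) y) := by
    intro n
    induction n with
    | zero => simp
    | succ n ih =>
      intro x y
      rw [pow_succ, mul_apply_eq_comp, ih, hT, ← mul_apply_eq_comp,
        ← pow_succ', pow_succ]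
  have hsq : ∀ n : ℕ, ‖(T ^ n) v‖ ^ 2 ≤ C * (r ^ 2) ^ n := by
    intro n
    have h1 := h (2 * n)
    rw [two_mul, pow_add, mul_apply_eq_comp, hsymm, inner_self_eq_norm_sq_to_K] at h1
    rw [← pow_mul, two_mul]
    simpa using h1
  set q : ℝ := (‖T v‖ / (r * ‖v‖)) ^ 2 with hq
  have hq1 : 1 < q := by
    have : 1 < ‖T v‖ / (r * ‖v‖) := (one_lt_div (by positivity)).2 hlt
    exact one_lt_pow₀ this two_ne_zero
  obtain ⟨n, hn⟩ := pow_unbounded_of_one_lt (C / ‖v‖ ^ 2) hq1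
  have h1 : q ^ n ≤ C / ‖v‖ ^ 2 := by
    rw [le_div_iff₀ (by positivity)]
    have h2 : (‖T v‖ ^ n * ‖v‖) ^ 2 ≤ C * (r ^ 2) ^ n * (‖v‖ ^ n) ^ 2 := by
      calc (‖T v‖ ^ n * ‖v‖) ^ 2 ≤ (‖(T ^ n) v‖ * ‖v‖ ^ n) ^ 2 := by exact pow_le_pow_left₀ (by positivity) (hpow n) 2
        _ = ‖(T ^ n) v‖ ^ 2 * (‖v‖ ^ n) ^ 2 := by ring
        _ ≤ _ := by gcongr; exact hsq n
    have h3 : q ^ n * ‖v‖ ^ 2 = (‖T v‖ ^ n * ‖v‖) ^ 2 / ((r ^ 2) ^ n * (‖v‖ ^ n) ^ 2) := by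
      rw [hq, div_pow, div_pow, eq_div_iff (by positivity)]
      field_simp
      ring
    rw [h3, div_le_iff₀ (by positivity)]
    linarith
  linarith

end FixedVectors

/-! ### Spectral gap for representations of symmetric groups. -/

section PermRepresentations

variable {X H : Type*} [NormedAddCommGroup H] [InnerProductSpace ℂ H]

/-- Every permutation agrees on a given finite set with a product of transpositions. -/
theorem exists_mem_closure_isSwap_eqOn [DecidableEq X] (σ : Equiv.Perm X) (A : Finset X) :
    ∃ g ∈ Subgroup.closure {τ : Equiv.Perm X | τ.IsSwap}, ∀ a ∈ A, g a = σ a := by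
  induction A using Finset.induction_on with
  | empty => exact ⟨1, Subgroup.one_mem _, by simp⟩
  | insert a A ha ih =>
    obtain ⟨g, hg, hgA⟩ := ih
    by_cases hfix : g a = σ a
    · refine ⟨g, hg, fun x hx => ?_⟩
      rcases Finset.mem_insert.1 hx with rfl | hx
      · exact hfix
      · exact hgA x hx
    · refine ⟨Equiv.swap (g a) (σ a) * g, Subgroup.mul_mem _
        (Subgroup.subset_closure ⟨_, _, hfix, rfl⟩) hg, fun x hx => ?_⟩
      rcases Finset.mem_insert.1 hx with rfl | hx
      · simp
      · have hxa : x ≠ a := fun e => ha (e ▸ hx)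
        rw [Equiv.Perm.mul_apply, Equiv.swap_apply_of_ne_of_ne (g.injective.ne hxa), hgA x hx]
        rw [hgA x hx]
        exact σ.injective.ne hxa

/-- There is a permutation fixing a finite set `B` pointwise whose powers move every point outside
`B` to infinity. -/
theorem exists_perm_tendsto_cofinite [Infinite X] [Countable X] (B : Finset X) :
    ∃ τ : Equiv.Perm X, (∀ b ∈ B, τ b = b) ∧
      ∀ x ∉ B, Tendsto (fun n : ℕ => (τ ^ n) x) atTop cofinite := by
  classical
  have hinf : Infinite {x : X // x ∉ B} := (B.finite_toSet.infinite_compl).to_subtype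
  -- The permutation is the shift of `ℤ`, transported to the complement of `B`.
  obtain ⟨e⟩ : Nonempty ({x : X // x ∉ B} ≃ ℤ) := nonempty_equiv_of_countable
  let τ₀ : Equiv.Perm {x : X // x ∉ B} := e.symm.permCongr (Equiv.addRight 1)
  refine ⟨Equiv.Perm.ofSubtype τ₀, fun b hb => ?_, fun x hx => ?_⟩
  · exact Equiv.Perm.ofSubtype_apply_of_not_mem _ (by simpa using hb)
  have hpow : ∀ n : ℕ, (τ₀ ^ n) ⟨x, hx⟩ = e.symm (e ⟨x, hx⟩ + n) := by
    intro n
    induction n with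
    | zero => simp
    | succ n ih =>
      rw [pow_succ', Equiv.Perm.mul_apply, ih]
      simp [τ₀, Equiv.permCongr_apply, add_assoc]
  have hval : ∀ n : ℕ, (Equiv.Perm.ofSubtype τ₀ ^ n) x = (e.symm (e ⟨x, hx⟩ + n) : X) := by
    intro n
    rw [← map_pow, ← hpow]
    exact Equiv.Perm.ofSubtype_apply_of_mem (p := fun x => x ∉ B) (τ₀ ^ n) hx
  have hinj : Function.Injective fun n : ℕ => (Equiv.Perm.ofSubtype τ₀ ^ n) x := by
    intro m n hmn
    simp only [hval] at hmn
    simpa using e.symm.injective (Subtype.ext hmn)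
  rw [← Nat.cofinite_eq_atTop]
  exact hinj.tendsto_cofinite

/-- In a continuous unitary representation of a symmetric group without invariant vectors, vectors
fixed by the pointwise stabilizers of disjoint finite sets are orthogonal. -/
theorem inner_eq_zero_of_disjoint_fixed [CompleteSpace H] [Infinite X] [Countable X]
    (π : Equiv.Perm X →* (H ≃ₗᵢ[ℂ] H))
    (hcont : ∀ (v : H) (ε : ℝ), 0 < ε → ∃ A : Finset X, ∀ σ : Equiv.Perm X, (∀ a ∈ A, σ a = a) →
      ‖π σ v - v‖ ≤ ε)
    (hinv : ∀ v : H, (∀ σ, π σ v = v) → v = 0) {A B : Finset X} (hAB : Disjoint A B) {v w : H}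
    (hv : ∀ σ : Equiv.Perm X, (∀ a ∈ A, σ a = a) → π σ v = v)
    (hw : ∀ σ : Equiv.Perm X, (∀ b ∈ B, σ b = b) → π σ w = w) : inner ℂ v w = 0 := by
  classical
  obtain ⟨τ, hτB, hτ⟩ := exists_perm_tendsto_cofinite B
  have hpowB : ∀ n : ℕ, ∀ b ∈ B, (τ ^ n) b = b := by
    intro n b hb
    exact Equiv.Perm.pow_apply_eq_self_of_apply_eq_self (hτB b hb) n
  let f : H →L[ℂ] H := (π τ : H →L[ℂ] H)
  have hf : ‖f‖ ≤ 1 := ContinuousLinearMap.opNorm_le_bound _ zero_le_one fun x => by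
    rw [one_mul]
    exact ((π τ).norm_map x).le
  have hiter : ∀ n : ℕ, f^[n] v = π (τ ^ n) v := by
    intro n
    induction n with
    | zero => simp
    | succ n ih =>
      rw [Function.iterate_succ_apply', ih, pow_succ', map_mul]
      rfl
  -- Mean ergodic theorem. The limit `u` has the same inner product with `w` as `v` has, since `τ`
  -- fixes `B`; it will turn out to be invariant, hence zero.
  obtain ⟨u, hu⟩ : ∃ u, Tendsto (fun N : ℕ => birkhoffAverage ℂ f id N v) atTop (𝓝 u) :=
    ⟨_, f.tendsto_birkhoffAverage_orthogonalProjection hf v⟩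
  have hform : ∀ N : ℕ, birkhoffAverage ℂ f id N v =
      (N : ℂ)⁻¹ • ∑ n ∈ Finset.range N, π (τ ^ n) v := by
    intro N
    simp [birkhoffAverage, birkhoffSum, hiter]
  have huw : inner ℂ u w = inner ℂ v w := by
    have h1 : Tendsto (fun N : ℕ => inner ℂ (birkhoffAverage ℂ f id N v) w) atTop
        (𝓝 (inner ℂ u w)) := hu.inner tendsto_const_nhds
    refine tendsto_nhds_unique h1 (tendsto_const_nhds.congr' ?_)
    filter_upwards [eventually_gt_atTop 0] with N hN
    have h2 : ∀ n : ℕ, inner ℂ (π (τ ^ n) v) w = inner ℂ v w := by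
      intro n
      conv_lhs => rw [← hw (τ ^ n) (hpowB n)]
      exact (π (τ ^ n)).inner_map_map v w
    rw [hform, inner_smul_left, sum_inner, Finset.sum_congr rfl fun n _ => h2 n]
    have : (N : ℂ) ≠ 0 := by exact_mod_cast hN.ne'
    simp [this]
  have hswap : ∀ g : Equiv.Perm X, g.IsSwap → π g u = u := by
    rintro g ⟨x, y, -, rfl⟩
    set g : Equiv.Perm X := Equiv.swap x y
    -- For large `n` the set `τ ^ n A` avoids the transposed points, so the transposition fixes `π
    -- (τ ^ n) v`; the finitely many earlier terms vanish in the average.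
    have hev : ∀ᶠ n in atTop, ∀ a ∈ A, (τ ^ n) a ∉ ({x, y} : Finset X) := by
      refine (Finset.eventually_all A).2 fun a ha => ?_
      exact (hτ a (Finset.disjoint_left.1 hAB ha)).eventually
        (Finset.finite_toSet _).compl_mem_cofinite
    obtain ⟨n₀, hn₀⟩ := eventually_atTop.1 hev
    have hfix : ∀ n ≥ n₀, π g (π (τ ^ n) v) = π (τ ^ n) v := by
      intro n hn
      have h1 : π ((τ ^ n)⁻¹ * g * τ ^ n) v = v := by
        refine hv _ fun a ha => ?_
        have := hn₀ n hn a ha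
        simp only [Finset.mem_insert, Finset.mem_singleton, not_or] at this
        rw [Equiv.Perm.mul_apply, Equiv.Perm.mul_apply,
          Equiv.swap_apply_of_ne_of_ne this.1 this.2, Equiv.Perm.inv_def, Equiv.symm_apply_apply]
      conv_rhs => rw [← h1]
      rw [← hom_mul_apply, ← hom_mul_apply]
      congr 2
      group
    have h1 : Tendsto (fun N : ℕ => π g (birkhoffAverage ℂ f id N v) - birkhoffAverage ℂ f id N v)
        atTop (𝓝 (π g u - u)) := (((π g).continuous.tendsto u).comp hu).sub hu
    have h2 : Tendsto (fun N : ℕ => (N : ℂ)⁻¹ •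
        ∑ n ∈ Finset.range n₀, (π g (π (τ ^ n) v) - π (τ ^ n) v)) atTop (𝓝 0) := by
      simpa using (tendsto_inv_atTop_nhds_zero_nat (𝕜 := ℂ)).smul_const
        (∑ n ∈ Finset.range n₀, (π g (π (τ ^ n) v) - π (τ ^ n) v))
    refine sub_eq_zero.1 (tendsto_nhds_unique h1 (h2.congr' ?_))
    filter_upwards [eventually_ge_atTop n₀] with N hN
    rw [hform, map_smul, map_sum, ← smul_sub, ← Finset.sum_sub_distrib]
    congr 1
    refine Finset.sum_subset (Finset.range_mono hN) fun n _ hn => ?_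
    rw [hfix n (by simpa using hn), sub_self]
  have hclosure : ∀ g ∈ Subgroup.closure {τ : Equiv.Perm X | τ.IsSwap}, π g u = u := by
    intro g hg
    induction hg using Subgroup.closure_induction with
    | mem g hg => exact hswap g hg
    | one => simp
    | mul a b _ _ ha hb => rw [hom_mul_apply, hb, ha]
    | inv a _ ha =>
      conv_lhs => rw [← ha]
      rw [← hom_mul_apply]
      simp
  -- Finitary permutations are dense in the symmetric group, so continuity extends the invariance of
  -- `u` to all of it.
  have hu0 : u = 0 := by
    refine hinv u fun σ => ?_
    refine sub_eq_zero.1 (norm_le_zero_iff.1 (le_of_forall_pos_le_add fun ε hε => ?_))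
    rw [zero_add]
    obtain ⟨C, hC⟩ := hcont u ε hε
    obtain ⟨g, hg, hgC⟩ := exists_mem_closure_isSwap_eqOn σ C
    have h1 := hC (g⁻¹ * σ) fun a ha => by
      rw [Equiv.Perm.mul_apply, ← hgC a ha, Equiv.Perm.inv_def, Equiv.symm_apply_apply]
    have h2 : π σ u - u = π g (π (g⁻¹ * σ) u - u) := by
      rw [map_sub, hclosure g hg, ← hom_mul_apply]
      simp
    rw [h2, LinearIsometryEquiv.norm_map]
    exact h1
  rw [← huw, hu0, inner_zero_left]

/-- If a positive function `f` on `X` satisfies `∑ i, f (s i x) ≤ c * f x`, then the powers of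
`∑ i, π (s i)` have matrix coefficients of growth rate `c` on vectors fixed by the pointwise
stabilizers of finite sets. -/
theorem norm_inner_sum_pow_le [CompleteSpace H] [Infinite X] [Countable X] {ι : Type*} [Fintype ι]
    (π : Equiv.Perm X →* (H ≃ₗᵢ[ℂ] H))
    (hcont : ∀ (v : H) (ε : ℝ), 0 < ε → ∃ A : Finset X, ∀ σ : Equiv.Perm X, (∀ a ∈ A, σ a = a) →
      ‖π σ v - v‖ ≤ ε)
    (hinv : ∀ v : H, (∀ σ, π σ v = v) → v = 0) (s : ι → Equiv.Perm X) (T : H →L[ℂ] H)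
    (hT : ∀ v, T v = ∑ i, π (s i) v) {f : X → ℝ} (hf : ∀ x, 0 < f x) {c : ℝ} (hc : 0 ≤ c)
    (hsf : ∀ x, ∑ i, f (s i x) ≤ c * f x) {B : Finset X} {w : H}
    (hw : ∀ σ : Equiv.Perm X, (∀ b ∈ B, σ b = b) → π σ w = w) (n : ℕ) (A : Finset X) (v : H)
    (hv : ∀ σ : Equiv.Perm X, (∀ a ∈ A, σ a = a) → π σ v = v) :
    ‖inner ℂ ((T ^ n) v) w‖ ≤ ‖v‖ * ‖w‖ * c ^ n * ∑ x ∈ A, ∑ y ∈ B, f x / f y := by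
  classical
  induction n generalizing A v with
  | zero =>
    have hnn : ∀ x y, 0 ≤ f x / f y := fun x y => (div_pos (hf x) (hf y)).le
    -- Disjoint sets give orthogonal vectors; a common point contributes the term `f x / f x = 1`,
    -- and Cauchy–Schwarz suffices.
    by_cases hAB : Disjoint A B
    · have h0 : inner ℂ v w = 0 := inner_eq_zero_of_disjoint_fixed π hcont hinv hAB hv hw
      rw [pow_zero, one_apply_eq_self, h0, norm_zero]
      have := Finset.sum_nonneg fun x (_ : x ∈ A) => Finset.sum_nonneg fun y (_ : y ∈ B) => hnn x y
      positivity
    · obtain ⟨x, hxA, hxB⟩ := Finset.not_disjoint_iff.1 hAB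
      have h1 : (1 : ℝ) ≤ ∑ x ∈ A, ∑ y ∈ B, f x / f y :=
        calc (1 : ℝ) = f x / f x := (div_self (hf x).ne').symm
          _ ≤ ∑ y ∈ B, f x / f y :=
            Finset.single_le_sum (f := fun y => f x / f y) (fun y _ => hnn x y) hxB
          _ ≤ _ := Finset.single_le_sum (f := fun x => ∑ y ∈ B, f x / f y)
            (fun x _ => Finset.sum_nonneg fun y _ => hnn x y) hxA
      rw [pow_zero, pow_zero, mul_one, one_apply_eq_self]
      exact (norm_inner_le_norm v w).trans (le_mul_of_one_le_right (by positivity) h1)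
  | succ n ih =>
    -- The vector `π (s i) v` is fixed by the stabilizer of `s i A`, so the induction hypothesis
    -- applies to the translated set.
    have hstep : ∀ i, ‖inner ℂ ((T ^ n) (π (s i) v)) w‖ ≤
        ‖v‖ * ‖w‖ * c ^ n * ∑ x ∈ A, ∑ y ∈ B, f (s i x) / f y := by
      intro i
      have h1 := ih (A.map (s i).toEmbedding) (π (s i) v) fun σ hσ => by
        have h2 : π ((s i)⁻¹ * σ * s i) v = v := hv _ fun a ha => by
          have h3 : σ (s i a) = s i a := hσ _ (Finset.mem_map.2 ⟨a, ha, rfl⟩)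
          rw [Equiv.Perm.mul_apply, Equiv.Perm.mul_apply, h3, Equiv.Perm.inv_def, Equiv.symm_apply_apply]
        conv_rhs => rw [← h2]
        rw [← hom_mul_apply, ← hom_mul_apply]
        congr 2
        group
      rw [LinearIsometryEquiv.norm_map, Finset.sum_map] at h1
      exact h1
    have hsum : ∑ i, ∑ x ∈ A, ∑ y ∈ B, f (s i x) / f y ≤ c * ∑ x ∈ A, ∑ y ∈ B, f x / f y := by
      rw [Finset.sum_comm, Finset.mul_sum]
      refine Finset.sum_le_sum fun x _ => ?_
      rw [Finset.sum_comm, Finset.mul_sum]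
      refine Finset.sum_le_sum fun y _ => ?_
      rw [← Finset.sum_div, ← mul_div_assoc]
      exact div_le_div_of_nonneg_right (hsf x) (hf y).le
    rw [pow_succ, mul_apply_eq_comp, hT, map_sum, sum_inner]
    calc ‖∑ i, inner ℂ ((T ^ n) (π (s i) v)) w‖
        ≤ ∑ i, ‖inner ℂ ((T ^ n) (π (s i) v)) w‖ := norm_sum_le _ _
      _ ≤ ∑ i, ‖v‖ * ‖w‖ * c ^ n * ∑ x ∈ A, ∑ y ∈ B, f (s i x) / f y :=
        Finset.sum_le_sum fun i _ => hstep i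
      _ = ‖v‖ * ‖w‖ * c ^ n * ∑ i, ∑ x ∈ A, ∑ y ∈ B, f (s i x) / f y := by rw [Finset.mul_sum]
      _ ≤ ‖v‖ * ‖w‖ * c ^ n * (c * ∑ x ∈ A, ∑ y ∈ B, f x / f y) := by gcongr
      _ = _ := by ring

/-- A spectral gap for continuous unitary representations of the symmetric group of a countable
set. -/
theorem norm_sum_unitary_apply_le [CompleteSpace H] [Infinite X] [Countable X] {ι : Type*}
    [Fintype ι] (π : Equiv.Perm X →* (H ≃ₗᵢ[ℂ] H))
    (hcont : ∀ (v : H) (ε : ℝ), 0 < ε → ∃ A : Finset X, ∀ σ : Equiv.Perm X, (∀ a ∈ A, σ a = a) →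
      ‖π σ v - v‖ ≤ ε)
    (hinv : ∀ v : H, (∀ σ, π σ v = v) → v = 0) (s : ι → Equiv.Perm X) (j : Equiv.Perm ι)
    (hj : ∀ i, s (j i) = (s i)⁻¹) {f : X → ℝ} (hf : ∀ x, 0 < f x) {c : ℝ} (hc : 0 < c)
    (hsf : ∀ x, ∑ i, f (s i x) ≤ c * f x) (v : H) : ‖∑ i, π (s i) v‖ ≤ c * ‖v‖ := by
  let T : H →L[ℂ] H := ∑ i, (π (s i) : H →L[ℂ] H)
  have hT : ∀ v, T v = ∑ i, π (s i) v := fun v => by simp [T]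
  have hsymm : ∀ x y, inner ℂ (T x) y = inner ℂ x (T y) := by
    intro x y
    rw [hT, hT, sum_inner, inner_sum, ← Equiv.sum_comp j]
    refine Finset.sum_congr rfl fun i _ => ?_
    rw [hj, ← (π (s i)).inner_map_map, ← hom_mul_apply, mul_inv_cancel, map_one]
    rfl
  rw [← hT]
  refine le_of_forall_pos_le_add fun ε hε => ?_
  -- The approximation error `δ` enters once with factor `‖T‖` and once with factor `c`.
  set δ : ℝ := ε / (‖T‖ + c) with hδ
  have hpos : 0 < ‖T‖ + c := by positivity
  obtain ⟨A, hA⟩ := hcont v δ (by positivity)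
  obtain ⟨u, huv, hu⟩ := exists_fixed_near_of_norm_sub_le π
    (fixingSubgroup (Equiv.Perm X) (A : Set X)) (v := v) (ε := δ) fun g hg =>
      hA g fun a ha => (mem_fixingSubgroup_iff _).1 hg a ha
  have hu' : ∀ σ : Equiv.Perm X, (∀ a ∈ A, σ a = a) → π σ u = u := fun σ hσ =>
    hu σ ((mem_fixingSubgroup_iff _).2 hσ)
  have hgap : ‖T u‖ ≤ c * ‖u‖ := by
    refine norm_symmetric_apply_le T hsymm hc
      (C := ‖u‖ * ‖u‖ * ∑ x ∈ A, ∑ y ∈ A, f x / f y) fun n => ?_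
    refine (norm_inner_sum_pow_le π hcont hinv s T hT hf hc.le hsf hu' n A u hu').trans (le_of_eq ?_)
    ring
  have h1 : ‖T v‖ ≤ ‖T u‖ + ‖T‖ * δ := by
    have h2 : T v = T u - T (u - v) := by rw [map_sub]; abel
    rw [h2]
    refine (norm_sub_le _ _).trans ?_
    gcongr
    exact (T.le_opNorm _).trans (by gcongr)
  have h3 : ‖u‖ ≤ ‖v‖ + δ := by
    have : u = v + (u - v) := by abel
    rw [this]
    exact (norm_add_le _ _).trans (by gcongr)
  have h4 : (‖T‖ + c) * δ = ε := by rw [hδ]; field_simp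
  calc ‖T v‖ ≤ c * ‖u‖ + ‖T‖ * δ := by linarith
    _ ≤ c * (‖v‖ + δ) + ‖T‖ * δ := by gcongr
    _ = c * ‖v‖ + ε := by rw [← h4]; ring

end PermRepresentations

/-! ### The free group of rank two as index set. -/

section FreeGroupShift

/-- The function `2 ^ (-|x|)` on the free group of rank two is a strictly superharmonic function of
the simple random walk. -/
theorem FreeGroup.sum_half_pow_norm_mul_le (x : FreeGroup Bool) :
    ∑ p : Bool × Bool, (1 / 2 : ℝ) ^ (FreeGroup.mk [p] * x).norm ≤ 7 / 2 * (1 / 2 : ℝ) ^ x.norm := by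
  have key : ∀ p : Bool × Bool, (FreeGroup.mk [p] * x).norm =
      (List.casesOn (motive := fun _ => List (Bool × Bool)) x.toWord [p] fun hd tl =>
        if p.1 = hd.1 ∧ p.2 = not hd.2 then tl else p :: hd :: tl).length := by
    intro p
    rw [FreeGroup.norm, FreeGroup.toWord_mul, FreeGroup.toWord_mk, FreeGroup.reduce_singleton,
      List.singleton_append, FreeGroup.reduce.cons, FreeGroup.reduce_toWord]
  simp only [key]
  rw [FreeGroup.norm]
  -- At the identity the four terms sum to `2`. Elsewhere exactly one letter cancels, and the sum is
  -- `2 + 3 / 2 = 7 / 2` times the value at `x`.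
  rcases x.toWord with _ | ⟨⟨a, b⟩, t⟩
  · norm_num
  · rcases a <;> rcases b <;> simp [Fintype.sum_prod_type, pow_succ] <;>
      nlinarith [show (0 : ℝ) < (2 ^ t.length)⁻¹ by positivity]

instance : Countable (FreeGroup Bool) :=
  FreeGroup.toWord_injective.countable

/-- Left translation by a letter of the free group. -/
noncomputable def letterPerm (p : Bool × Bool) : Equiv.Perm (FreeGroup Bool) :=
  Equiv.mulLeft (FreeGroup.mk [p])

/-- The permutation of the letters which inverts them. -/
def letterInv : Equiv.Perm (Bool × Bool) := Equiv.prodCongr (Equiv.refl Bool) Equiv.boolNot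

theorem letterPerm_letterInv (p : Bool × Bool) : letterPerm (letterInv p) = (letterPerm p)⁻¹ := by
  rw [letterPerm, letterPerm, Equiv.Perm.inv_def, Equiv.mulLeft_symm, FreeGroup.inv_mk]
  rfl

/-- A Kazhdan-type inequality for the symmetric group of the free group of rank two. -/
theorem norm_sum_letterPerm_le {H : Type*} [NormedAddCommGroup H] [InnerProductSpace ℂ H]
    [CompleteSpace H] (π : Equiv.Perm (FreeGroup Bool) →* (H ≃ₗᵢ[ℂ] H))
    (hcont : ∀ (v : H) (ε : ℝ), 0 < ε → ∃ A : Finset (FreeGroup Bool),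
      ∀ σ : Equiv.Perm (FreeGroup Bool), (∀ a ∈ A, σ a = a) → ‖π σ v - v‖ ≤ ε)
    (hinv : ∀ v : H, (∀ σ, π σ v = v) → v = 0) (v : H) :
    ‖∑ p, π (letterPerm p) v‖ ≤ 7 / 2 * ‖v‖ :=
  norm_sum_unitary_apply_le π hcont hinv letterPerm letterInv letterPerm_letterInv
    (f := fun x => (1 / 2 : ℝ) ^ x.norm) (fun x => by positivity) (by norm_num)
    FreeGroup.sum_half_pow_norm_mul_le v

end FreeGroupShift

/-! ### Ultrametrics are of negative type. -/

section Kernels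

/-- A positive semidefinite real kernel is the Gram matrix of a total family in a Hilbert space. -/
theorem exists_hilbert_of_posSemidef {X : Type} (k : X → X → ℝ) (hsymm : ∀ x y, k x y = k y x)
    (hpos : ∀ a : X →₀ ℝ, 0 ≤ ∑ x ∈ a.support, ∑ y ∈ a.support, a x * a y * k x y) :
    ∃ (H : Type) (_ : NormedAddCommGroup H) (_ : InnerProductSpace ℝ H) (_ : CompleteSpace H)
      (u : X → H), (∀ x y, inner ℝ (u x) (u y) = k x y) ∧
        Dense (Submodule.span ℝ (Set.range u) : Set H) := by
  let K : Matrix X X (ℝ →L[ℝ] ℝ) := Matrix.of fun x y => k x y • ContinuousLinearMap.id ℝ ℝ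
  have hK : K.PosSemidef := by
    have htfae := (RKHS.posSemidef_tfae (K := K)).out 0 2
    refine htfae.mpr ⟨?_, fun a => ?_⟩
    · have hid : star (ContinuousLinearMap.id ℝ ℝ) = ContinuousLinearMap.id ℝ ℝ :=
        star_one (ℝ →L[ℝ] ℝ)
      ext x y
      simp [K, hsymm y x, hid]
    · refine (hpos a).trans (le_of_eq ?_)
      simp only [Finsupp.sum]
      rw [RCLike.re_to_real]
      refine Finset.sum_congr rfl fun x _ => Finset.sum_congr rfl fun y _ => ?_
      simp [K, hsymm y x]
      ring
  have : Fact K.PosSemidef := ⟨hK⟩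
  refine ⟨RKHS.OfKernel K, inferInstance, inferInstance, inferInstance,
    fun x => RKHS.kerFun (RKHS.OfKernel K) x 1, fun x y => ?_, ?_⟩
  · rw [← RKHS.kernel_inner, RKHS.OfKernel.kernel_ofKernel]
    simp [K, hsymm y x]
  · have h := RKHS.kerFun_dense (H := RKHS.OfKernel K)
    rw [Submodule.dense_iff_topologicalClosure_eq_top, eq_top_iff, ← h]
    refine Submodule.topologicalClosure_mono (Submodule.span_le.2 ?_)
    rintro _ ⟨x, c, rfl⟩
    have : RKHS.kerFun (RKHS.OfKernel K) x c = c • RKHS.kerFun (RKHS.OfKernel K) x 1 := by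
      rw [← map_smul, smul_eq_mul, mul_one]
    rw [this]
    exact Submodule.smul_mem _ _ (Submodule.subset_span ⟨x, rfl⟩)

/-- The kernel of an equivalence relation, based at a point, is positive semidefinite. -/
theorem sum_equivalence_kernel_nonneg {X : Type*} {r : X → X → Prop} [DecidableRel r]
    (hr : Equivalence r) (o : X) (s : Finset X) (a : X → ℝ) :
    0 ≤ ∑ x ∈ s, ∑ y ∈ s, a x * a y * ((if r x o then 0 else 1) + (if r y o then 0 else 1) -
      (if r x y then 0 else 1)) := by
  classical
  let q : X → Quotient (⟨r, hr⟩ : Setoid X) := Quotient.mk _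
  have hq : ∀ x y, r x y ↔ q x = q y := fun x y => (Quotient.eq (r := ⟨r, hr⟩)).symm
  let C := (insert o s).image q
  have hC : ∀ x ∈ insert o s, q x ∈ C := fun x hx => Finset.mem_image_of_mem q hx
  -- The kernel is the Gram matrix of the vectors `e_{q x} - e_{q o}`, with one coordinate for each
  -- class.
  let φ : Quotient (⟨r, hr⟩ : Setoid X) → X → ℝ := fun c x =>
    (if q x = c then 1 else 0) - (if q o = c then 1 else 0)
  have ho := hC o (Finset.mem_insert_self o s)
  have key : ∀ x ∈ s, ∀ y ∈ s, ((if r x o then 0 else 1) + (if r y o then 0 else 1) -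
      (if r x y then 0 else 1) : ℝ) = ∑ c ∈ C, φ c x * φ c y := by
    intro x hx y hy
    have hx' := hC x (Finset.mem_insert_of_mem hx)
    have hy' := hC y (Finset.mem_insert_of_mem hy)
    simp only [φ, sub_mul, mul_sub, Finset.sum_sub_distrib, hq, ite_mul, one_mul, zero_mul,
      Finset.sum_ite_eq, hx', ho, if_true]
    simp only [eq_comm (a := q y) (b := q x), eq_comm (a := q y) (b := q o),
      eq_comm (a := q x) (b := q o)]
    split_ifs <;> norm_num
  have : ∑ x ∈ s, ∑ y ∈ s, a x * a y * ((if r x o then 0 else 1) + (if r y o then 0 else 1) -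
      (if r x y then 0 else 1) : ℝ) = ∑ c ∈ C, (∑ x ∈ s, a x * φ c x) ^ 2 := by
    calc _ = ∑ x ∈ s, ∑ y ∈ s, ∑ c ∈ C, (a x * φ c x) * (a y * φ c y) := by
          refine Finset.sum_congr rfl fun x hx => Finset.sum_congr rfl fun y hy => ?_
          rw [key x hx y hy, Finset.mul_sum]
          exact Finset.sum_congr rfl fun c _ => by ring
      _ = ∑ x ∈ s, ∑ c ∈ C, ∑ y ∈ s, (a x * φ c x) * (a y * φ c y) :=
          Finset.sum_congr rfl fun x _ => Finset.sum_comm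
      _ = ∑ c ∈ C, ∑ x ∈ s, ∑ y ∈ s, (a x * φ c x) * (a y * φ c y) := Finset.sum_comm
      _ = _ := Finset.sum_congr rfl fun c _ => by rw [sq, Finset.sum_mul_sum]
  rw [this]
  exact Finset.sum_nonneg fun c _ => sq_nonneg _

theorem integral_ite_le_eq {d M : ℝ} (hd : 0 ≤ d) (hdM : d ≤ M) :
    ∫ t in Set.Ioc 0 M, (if d ≤ t then (0 : ℝ) else 1) = d := by
  have h1 : (fun t : ℝ => if d ≤ t then (0 : ℝ) else 1) = (Set.Iio d).indicator fun _ => 1 := by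
    ext t
    by_cases h : d ≤ t
    · simp [h]
    · simp [h, lt_of_not_ge h]
  have h2 : Set.Ioc 0 M ∩ Set.Iio d = Set.Ioo 0 d := by
    ext t
    simp only [Set.mem_inter_iff, Set.mem_Ioc, Set.mem_Iio, Set.mem_Ioo]
    exact ⟨fun h => ⟨h.1.1, h.2⟩, fun h => ⟨⟨h.1, h.2.le.trans hdM⟩, h.2⟩⟩
  rw [h1, MeasureTheory.setIntegral_indicator measurableSet_Iio, h2]
  simp [hd]

theorem integrableOn_ite_le (d M : ℝ) :
    MeasureTheory.IntegrableOn (fun t : ℝ => if d ≤ t then (0 : ℝ) else 1) (Set.Ioc 0 M) := by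
  refine MeasureTheory.Measure.integrableOn_of_bounded (M := 1) (by simp) ?_ ?_
  · exact (Measurable.ite measurableSet_Ici measurable_const measurable_const).aestronglyMeasurable
  · refine Eventually.of_forall fun t => ?_
    split_ifs <;> simp

/-- Any ultrametric is a kernel of negative type. -/
theorem sum_ultrametric_kernel_nonneg {X : Type*} (D : X → X → ℝ) (hself : ∀ x, D x x = 0)
    (hsymm : ∀ x y, D x y = D y x) (hmax : ∀ x y z, D x z ≤ max (D x y) (D y z)) (o : X)
    (s : Finset X) (a : X → ℝ) :
    0 ≤ ∑ x ∈ s, ∑ y ∈ s, a x * a y * (D x o + D y o - D x y) := by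
  have hnn : ∀ x y, 0 ≤ D x y := fun x y => by
    have := hmax x y x
    rwa [hself, hsymm y x, max_self] at this
  obtain ⟨M, hM⟩ : ∃ M, ∀ x ∈ s, D x o ≤ M :=
    (s.finite_toSet.image fun x => D x o).bddAbove.imp fun M h x hx => h ⟨x, hx, rfl⟩
  have hM2 : ∀ x ∈ s, ∀ y ∈ s, D x y ≤ M := fun x hx y hy =>
    (hmax x o y).trans (max_le (hM x hx) (hsymm o y ▸ hM y hy))
  -- Layer-cake formula: `D x y` is the integral over `t` in `(0, M]` of the indicator of `D x y >
  -- t`, since `M` bounds all distances that occur.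
  let F : ℝ → X → X → ℝ := fun t x y => a x * a y * ((if D x o ≤ t then 0 else 1) +
    (if D y o ≤ t then 0 else 1) - (if D x y ≤ t then 0 else 1))
  have hint : ∀ x y, MeasureTheory.IntegrableOn (fun t => F t x y) (Set.Ioc 0 M) := fun x y =>
    (((integrableOn_ite_le _ _).add (integrableOn_ite_le _ _)).sub
      (integrableOn_ite_le _ _)).const_mul _
  have heq : ∑ x ∈ s, ∑ y ∈ s, a x * a y * (D x o + D y o - D x y) =
      ∫ t in Set.Ioc 0 M, ∑ x ∈ s, ∑ y ∈ s, F t x y := by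
    rw [MeasureTheory.integral_finsetSum _ fun x _ =>
      MeasureTheory.integrable_finsetSum _ fun y _ => hint x y]
    refine Finset.sum_congr rfl fun x hx => ?_
    rw [MeasureTheory.integral_finsetSum _ fun y _ => hint x y]
    refine Finset.sum_congr rfl fun y hy => ?_
    have hadd : MeasureTheory.IntegrableOn (fun t : ℝ => (if D x o ≤ t then (0 : ℝ) else 1) +
        (if D y o ≤ t then 0 else 1)) (Set.Ioc 0 M) :=
      (integrableOn_ite_le _ _).add (integrableOn_ite_le _ _)
    simp only [F]
    rw [MeasureTheory.integral_const_mul, MeasureTheory.integral_sub hadd (integrableOn_ite_le _ _),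
      MeasureTheory.integral_add (integrableOn_ite_le _ _) (integrableOn_ite_le _ _),
      integral_ite_le_eq (hnn _ _) (hM x hx), integral_ite_le_eq (hnn _ _) (hM y hy),
      integral_ite_le_eq (hnn _ _) (hM2 x hx y hy)]
  rw [heq]
  refine MeasureTheory.setIntegral_nonneg measurableSet_Ioc fun t ht => ?_
  exact sum_equivalence_kernel_nonneg (r := fun x y => D x y ≤ t)
    ⟨fun x => (hself x).trans_le ht.1.le, fun {x y} h => hsymm x y ▸ h,
      fun {x y z} h h' => (hmax x y z).trans (max_le h h')⟩ o s a

/-- The square root of an ultrametric embeds isometrically in a Hilbert space. -/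
theorem exists_hilbert_embedding_of_ultrametric {X : Type} (D : X → X → ℝ)
    (hself : ∀ x, D x x = 0) (hsymm : ∀ x y, D x y = D y x)
    (hmax : ∀ x y z, D x z ≤ max (D x y) (D y z)) (o : X) :
    ∃ (H : Type) (_ : NormedAddCommGroup H) (_ : InnerProductSpace ℝ H) (_ : CompleteSpace H)
      (ψ : X → H), (∀ x y, ‖ψ x - ψ y‖ ^ 2 = D x y) ∧ ψ o = 0 ∧
        Dense (Submodule.span ℝ (Set.range ψ) : Set H) := by
  -- The Gromov product based at `o`: with the factor `1 / 2` polarization returns `D`, and its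
  -- vanishing at `(o, o)` forces `ψ o = 0`.
  obtain ⟨H, i1, i2, i3, ψ, hψ, hd⟩ := exists_hilbert_of_posSemidef
    (fun x y => 1 / 2 * (D x o + D y o - D x y)) (fun x y => by rw [hsymm x y]; ring) fun a => by
      have h := sum_ultrametric_kernel_nonneg D hself hsymm hmax o a.support a
      have h2 : ∑ x ∈ a.support, ∑ y ∈ a.support, a x * a y * (1 / 2 * (D x o + D y o - D x y)) =
          1 / 2 * ∑ x ∈ a.support, ∑ y ∈ a.support, a x * a y * (D x o + D y o - D x y) := by
        simp only [Finset.mul_sum]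
        exact Finset.sum_congr rfl fun x _ => Finset.sum_congr rfl fun y _ => by ring
      rw [h2]
      positivity
  refine ⟨H, i1, i2, i3, ψ, fun x y => ?_, ?_, hd⟩
  · rw [norm_sub_sq_real, ← real_inner_self_eq_norm_sq, ← real_inner_self_eq_norm_sq, hψ, hψ, hψ,
      hself, hself]
    ring
  · rw [← inner_self_eq_zero (𝕜 := ℝ), hψ, hself]
    ring

end Kernels

/-! ### Affine extension of isometries of a total set. -/

section AffineActions

/-- Polarization: a permutation preserving distances preserves the Gram matrix of the differences,
which defines the linear part of the affine action. -/
theorem inner_sub_sub_eq_dist {H : Type*} [NormedAddCommGroup H] [InnerProductSpace ℝ H]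
    (a b c d : H) : inner ℝ (a - b) (c - d) =
      1 / 2 * (‖a - d‖ ^ 2 + ‖b - c‖ ^ 2 - ‖a - c‖ ^ 2 - ‖b - d‖ ^ 2) := by
  simp only [norm_sub_sq_real, inner_sub_left, inner_sub_right]
  ring

/-- Isometries of a total set of a real Hilbert space which contains the origin extend to a
continuous affine isometric action. -/
theorem exists_affineIsometricAction {G X H : Type*} [Group G] [TopologicalSpace G]
    [NormedAddCommGroup H] [InnerProductSpace ℝ H] [CompleteSpace H] (σ : G →* Equiv.Perm X)
    {ψ : X → H} {o : X} (ho : ψ o = 0) (hd : Dense (Submodule.span ℝ (Set.range ψ) : Set H))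
    (hσ : ∀ g x y, ‖ψ (σ g x) - ψ (σ g y)‖ = ‖ψ x - ψ y‖)
    (hc : ∀ x, Continuous fun g => ψ (σ g x)) :
    ∃ α : AffineIsometricAction G H, ∀ g x, α.toHom g (ψ x) = ψ (σ g x) := by
  let u : X × X → H := fun p => ψ p.1 - ψ p.2
  have hu : Dense (Submodule.span ℝ (Set.range u) : Set H) := by
    refine hd.mono (Submodule.span_mono ?_)
    rintro _ ⟨x, rfl⟩
    exact ⟨(x, o), by simp [u, ho]⟩
  let τ : G →* Equiv.Perm (X × X) :=
    { toFun := fun g => Equiv.prodCongr (σ g) (σ g)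
      map_one' := by ext p <;> simp
      map_mul' := fun g h => by ext p <;> simp }
  obtain ⟨L, hL⟩ := exists_unitary_hom_of_inner_eq (𝕜 := ℝ) hu τ fun g p q => by
    simp only [u, inner_sub_sub_eq_dist]
    simp [τ, hσ]
  have hL' : ∀ g x y, L g (ψ x - ψ y) = ψ (σ g x) - ψ (σ g y) := fun g x y => hL g (x, y)
  have hL0 : ∀ g x, L g (ψ x) = ψ (σ g x) - ψ (σ g o) := fun g x => by
    rw [← hL', ho, sub_zero]
  -- The linear part is followed by translation by the image of the origin `ψ o = 0`.
  let A : G → (H ≃ᵃⁱ[ℝ] H) := fun g =>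
    (L g).toAffineIsometryEquiv.trans (AffineIsometryEquiv.constVAdd ℝ H (ψ (σ g o)))
  have hA : ∀ g v, A g v = ψ (σ g o) + L g v := fun g v => rfl
  refine ⟨⟨MonoidHom.mk' A fun g h => ?_, fun v => ?_⟩, fun g x => ?_⟩
  · ext v
    change A (g * h) v = A g (A h v)
    rw [hA, hA, hA, map_add, hL0, hom_mul_apply, map_mul, Equiv.Perm.mul_apply]
    abel
  · refine (hc o).add (continuous_unitary_apply_of_dense hu (fun g => L g) (fun p => ?_) v)
    simp only [hL]
    exact (hc p.1).sub (hc p.2)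
  · change A g (ψ x) = _
    rw [hA, hL0]
    abel

end AffineActions

/-! ### Points, translations and separability of the Urysohn space. -/

namespace UrysohnSpace

variable {Λ : Set (Set.Ioi (0 : ℝ))}

/-- The value in `(0, ∞)` of an element of the spectrum. -/
abbrev radius (l : Λ) : ℝ := ((l : Set.Ioi (0 : ℝ)) : ℝ)

theorem radius_pos (l : Λ) : 0 < radius l := l.1.2

theorem radius_injective : Function.Injective (radius : Λ → ℝ) :=
  Subtype.val_injective.comp Subtype.val_injective

theorem exists_radius_eq_dist {x y : UrysohnSpace Λ} (h : x ≠ y) :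
    ∃ l : Λ, x.toFun l ≠ y.toFun l ∧ radius l = dist x y :=
  (isGreatest_dist h).1

/-- Maps that preserve the coordinatewise equality pattern preserve distances. -/
theorem dist_eq_of_toFun_eq_iff {x y x' y' : UrysohnSpace Λ}
    (h : ∀ l, x'.toFun l = y'.toFun l ↔ x.toFun l = y.toFun l) : dist x' y' = dist x y := by
  rw [dist_def, dist_def]
  congr 1
  ext t
  simp only [diffSet, ne_eq, h]

theorem eq_of_dist_lt {x y : UrysohnSpace Λ} {l : Λ} (h : dist x y < radius l) :
    x.toFun l = y.toFun l := by
  by_contra hne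
  exact (le_dist hne).not_gt h

/-- The function supported at one point. -/
noncomputable def single (l : Λ) (k : ℤ) : UrysohnSpace Λ where
  toFun := by
    classical exact Function.update 0 l k
  finite_support ε _ := (Set.finite_singleton l).subset fun m hm => by
    by_contra h
    exact hm.2 (by rw [Function.update_of_ne h, Pi.zero_apply])

instance : Zero (UrysohnSpace Λ) := ⟨⟨0, fun ε _ => by simp⟩⟩

@[simp] theorem zero_toFun (l : Λ) : (0 : UrysohnSpace Λ).toFun l = 0 := rfl

@[simp] theorem single_toFun_self (l : Λ) (k : ℤ) : (single l k).toFun l = k := by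
  simp [single]

theorem single_toFun_of_ne {l m : Λ} (h : m ≠ l) (k : ℤ) : (single l k).toFun m = 0 := by
  simp [single, Function.update_of_ne h]

theorem dist_single_zero (l : Λ) {k : ℤ} (hk : k ≠ 0) : dist (single l k) 0 = radius l := by
  have hne : single l k ≠ 0 := fun h => hk (by rw [← single_toFun_self l k, h, zero_toFun])
  obtain ⟨m, hm, hd⟩ := exists_radius_eq_dist hne
  rw [← hd]
  by_contra h
  exact hm (single_toFun_of_ne (fun e => h (by rw [e])) k)

/-- The function `x + b - a`. -/
def shift (a b x : UrysohnSpace Λ) : UrysohnSpace Λ where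
  toFun l := x.toFun l + b.toFun l - a.toFun l
  finite_support ε hε := (((x.finite_support ε hε).union (b.finite_support ε hε)).union
    (a.finite_support ε hε)).subset fun l hl => by
      by_contra h
      simp only [Set.mem_union, Set.mem_ofPred_eq, hl.1, true_and, not_or, not_not] at h
      exact hl.2 (by rw [h.1.1, h.1.2, h.2]; rfl)

/-- The translation which takes `a` to `b`. -/
noncomputable def translate (a b : UrysohnSpace Λ) : UrysohnIsom Λ where
  toFun := shift a b
  invFun := shift b a
  left_inv x := ext_fun fun l => by simp only [shift]; ring
  right_inv x := ext_fun fun l => by simp only [shift]; ring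
  isometry_toFun := Isometry.of_dist_eq fun x y => dist_eq_of_toFun_eq_iff fun l => by
    simp only [shift]
    constructor <;> intro h <;> linarith

theorem translate_toFun (a b x : UrysohnSpace Λ) (l : Λ) :
    (translate a b x).toFun l = x.toFun l + b.toFun l - a.toFun l := rfl

theorem translate_apply_self (a b : UrysohnSpace Λ) : translate a b a = b :=
  ext_fun fun l => by rw [translate_toFun]; ring

/-- Finitely supported functions form a countable set, dense because deleting the coordinates below
`ε` moves a point by less than `ε`. -/
theorem separableSpace (hΛ : Λ.Countable) : TopologicalSpace.SeparableSpace (UrysohnSpace Λ) := by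
  classical
  have : Countable Λ := hΛ.to_subtype
  refine ⟨⟨{x | (Function.support x.toFun).Finite}, ?_, ?_⟩⟩
  · refine Set.MapsTo.countable_of_injOn (t := Set.range fun f : Λ →₀ ℤ => (f : Λ → ℤ))
      (f := fun x : UrysohnSpace Λ => x.toFun) ?_ ?_ (Set.countable_range _)
    · intro x hx
      exact ⟨Finsupp.ofSupportFinite x.toFun hx, rfl⟩
    · intro x _ y _ h
      exact ext_fun fun l => congrFun h l
  · refine Metric.dense_iff.2 fun x ε hε => ?_
    let y : UrysohnSpace Λ := ⟨fun l => if ε ≤ radius l then x.toFun l else 0, fun δ hδ =>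
      (x.finite_support δ hδ).subset fun l hl => ⟨hl.1, fun h => hl.2 (by simp [h])⟩⟩
    refine ⟨y, ?_, (x.finite_support ε hε).subset fun l hl => ?_⟩
    · by_cases h : y = x
      · rw [h]
        exact Metric.mem_ball_self hε
      · obtain ⟨l, hl, hd⟩ := exists_radius_eq_dist h
        rw [Metric.mem_ball, ← hd]
        by_contra hle
        exact hl (if_pos (not_lt.1 hle))
    · by_contra h
      refine hl ?_
      change (if ε ≤ radius l then x.toFun l else 0) = 0
      by_cases hle : ε ≤ radius l
      · rw [if_pos hle]
        by_contra hx
        exact h ⟨hle, hx⟩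
      · rw [if_neg hle]

end UrysohnSpace

/-! ### The isometry group and permutations of one coordinate. -/

namespace UrysohnIsom

open UrysohnSpace

variable {Λ : Set (Set.Ioi (0 : ℝ))}

theorem continuous_eval (x : UrysohnSpace Λ) : Continuous fun g : UrysohnIsom Λ => g x :=
  (continuous_apply x).comp continuous_induced_dom

theorem mul_apply (g h : UrysohnIsom Λ) (x : UrysohnSpace Λ) : (g * h) x = g (h x) := rfl

theorem inv_apply_self (g : UrysohnIsom Λ) (x : UrysohnSpace Λ) : g⁻¹ (g x) = x :=
  g.symm_apply_apply x

theorem apply_inv_self (g : UrysohnIsom Λ) (x : UrysohnSpace Λ) : g (g⁻¹ x) = x :=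
  g.apply_symm_apply x

theorem ext_apply {g h : UrysohnIsom Λ} (H : ∀ x, g x = h x) : g = h := IsometryEquiv.ext H

/-- The action on the points of the space. -/
def permHom (Λ : Set (Set.Ioi (0 : ℝ))) : UrysohnIsom Λ →* Equiv.Perm (UrysohnSpace Λ) where
  toFun g := g.toEquiv
  map_one' := rfl
  map_mul' _ _ := rfl

theorem permHom_apply (g : UrysohnIsom Λ) (x : UrysohnSpace Λ) : permHom Λ g x = g x := rfl

/-- A neighborhood of the identity contains the pointwise stabilizer of a finite set. -/
theorem exists_finset_fixing_subset {S : Set (UrysohnIsom Λ)} (hS : S ∈ 𝓝 (1 : UrysohnIsom Λ)) :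
    ∃ F : Finset (UrysohnSpace Λ), ∀ g : UrysohnIsom Λ, (∀ x ∈ F, g x = x) → g ∈ S := by
  rw [nhds_induced, Filter.mem_comap] at hS
  obtain ⟨t, ht, htS⟩ := hS
  rw [nhds_pi, Filter.mem_pi] at ht
  obtain ⟨I, hI, U, hU, hIU⟩ := ht
  refine ⟨hI.toFinset, fun g hg => htS (hIU fun x hx => ?_)⟩
  change g x ∈ U x
  rw [hg x (hI.mem_toFinset.2 hx)]
  exact mem_of_mem_nhds (hU x)

theorem tendsto_of_eventually_eq {ι : Type*} {l : Filter ι} {f : ι → UrysohnIsom Λ}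
    {g : UrysohnIsom Λ} (h : ∀ x, ∀ᶠ i in l, f i x = g x) : Tendsto f l (𝓝 g) := by
  rw [nhds_induced, tendsto_comap_iff, tendsto_pi_nhds]
  exact fun x => tendsto_const_nhds.congr' ((h x).mono fun i hi => hi.symm)

section PermuteCoordinate

/-- Apply a function to the coordinate `m`. -/
noncomputable def mapAt (m : Λ) (f : ℤ → ℤ) (x : UrysohnSpace Λ) : UrysohnSpace Λ where
  toFun := by
    classical exact Function.update x.toFun m (f (x.toFun m))
  finite_support ε hε := ((x.finite_support ε hε).union (Set.finite_singleton m)).subset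
    fun l hl => by
      by_cases h : l = m
      · exact Or.inr h
      · refine Or.inl ⟨hl.1, ?_⟩
        have := hl.2
        rwa [Function.update_of_ne h] at this

@[simp] theorem mapAt_toFun_self (m : Λ) (f : ℤ → ℤ) (x : UrysohnSpace Λ) :
    (mapAt m f x).toFun m = f (x.toFun m) := by
  simp [mapAt]

theorem mapAt_toFun_of_ne {m l : Λ} (h : l ≠ m) (f : ℤ → ℤ) (x : UrysohnSpace Λ) :
    (mapAt m f x).toFun l = x.toFun l := by
  simp [mapAt, Function.update_of_ne h]

theorem mapAt_mapAt (m : Λ) (f g : ℤ → ℤ) (x : UrysohnSpace Λ) :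
    mapAt m f (mapAt m g x) = mapAt m (f ∘ g) x := by
  refine ext_fun fun l => ?_
  by_cases h : l = m
  · subst h
    simp
  · simp [mapAt_toFun_of_ne h]

theorem mapAt_eq_self {m : Λ} {f : ℤ → ℤ} {x : UrysohnSpace Λ} (hf : f (x.toFun m) = x.toFun m) :
    mapAt m f x = x := by
  refine ext_fun fun l => ?_
  by_cases h : l = m
  · subst h
    simpa using hf
  · simp [mapAt_toFun_of_ne h]

/-- The symmetric group of `ℤ` acts on the space through one coordinate. -/
noncomputable def permAt (m : Λ) : Equiv.Perm ℤ →* UrysohnIsom Λ where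
  toFun σ :=
    { toFun := mapAt m σ
      invFun := mapAt m σ.symm
      left_inv := fun x => by rw [mapAt_mapAt]; exact mapAt_eq_self (by simp)
      right_inv := fun x => by rw [mapAt_mapAt]; exact mapAt_eq_self (by simp)
      isometry_toFun := Isometry.of_dist_eq fun x y => dist_eq_of_toFun_eq_iff fun l => by
        by_cases h : l = m
        · subst h
          simp
        · simp [mapAt_toFun_of_ne h] }
  map_one' := ext_apply fun x => mapAt_eq_self rfl
  map_mul' σ τ := ext_apply fun x => (mapAt_mapAt m σ τ x).symm

theorem permAt_apply (m : Λ) (σ : Equiv.Perm ℤ) (x : UrysohnSpace Λ) :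
    permAt m σ x = mapAt m σ x := rfl

end PermuteCoordinate

/-! ### Property (T) when the spectrum has a maximum. -/

section MaximalRadius

variable {m : Λ}

theorem dist_eq_of_toFun_ne (hm : ∀ l : Λ, radius l ≤ radius m) {x y : UrysohnSpace Λ}
    (h : x.toFun m ≠ y.toFun m) : dist x y = radius m := by
  refine le_antisymm ?_ (le_dist h)
  obtain ⟨l, -, hd⟩ := exists_radius_eq_dist (x := x) (y := y) fun e => h (by rw [e])
  exact hd ▸ hm l

/-- The `m`-th coordinate labels the open balls of radius `m`, so isometries must permute its
values. -/
theorem dist_lt_iff (hm : ∀ l : Λ, radius l ≤ radius m) {x y : UrysohnSpace Λ} :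
    dist x y < radius m ↔ x.toFun m = y.toFun m := by
  refine ⟨eq_of_dist_lt, fun h => ?_⟩
  by_cases hxy : x = y
  · rw [hxy, dist_self]
    exact radius_pos m
  · obtain ⟨l, hl, hd⟩ := exists_radius_eq_dist hxy
    rw [← hd]
    refine lt_of_le_of_ne (hm l) fun e => hl ?_
    rw [radius_injective e, h]

theorem toFun_eq_iff (hm : ∀ l : Λ, radius l ≤ radius m) (g : UrysohnIsom Λ)
    (x y : UrysohnSpace Λ) : (g x).toFun m = (g y).toFun m ↔ x.toFun m = y.toFun m := by
  rw [← dist_lt_iff hm, ← dist_lt_iff hm, g.isometry.dist_eq]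

/-- An isometry permutes the maximal proper balls. -/
theorem exists_perm_toFun (hm : ∀ l : Λ, radius l ≤ radius m) (g : UrysohnIsom Λ) :
    ∃ σ : Equiv.Perm ℤ, ∀ x, (g x).toFun m = σ (x.toFun m) := by
  have key : ∀ (g : UrysohnIsom Λ) (x : UrysohnSpace Λ),
      (g (single m (x.toFun m))).toFun m = (g x).toFun m := fun g x => by
    rw [toFun_eq_iff hm, single_toFun_self]
  refine ⟨⟨fun k => (g (single m k)).toFun m, fun k => (g⁻¹ (single m k)).toFun m, fun k => ?_,
    fun k => ?_⟩, fun x => (key g x).symm⟩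
  · beta_reduce
    rw [key, inv_apply_self, single_toFun_self]
  · beta_reduce
    rw [key, apply_inv_self, single_toFun_self]

open Classical in
/-- Restrict an isometry which preserves the maximal proper balls to some of these balls. -/
noncomputable def restrictBalls (hm : ∀ l : Λ, radius l ≤ radius m) (h : UrysohnIsom Λ)
    (hh : ∀ x, (h x).toFun m = x.toFun m) (F : Set ℤ) : UrysohnIsom Λ where
  toFun x := if x.toFun m ∈ F then h x else x
  invFun x := if x.toFun m ∈ F then h⁻¹ x else x
  left_inv x := by
    by_cases hx : x.toFun m ∈ F
    · simp [hx, hh]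
    · simp [hx]
  right_inv x := by
    have hh' : (h⁻¹ x).toFun m = x.toFun m := by rw [← hh, apply_inv_self]
    by_cases hx : x.toFun m ∈ F
    · simp [hx, hh']
    · simp [hx]
  isometry_toFun := Isometry.of_dist_eq fun x y => by
    by_cases hxy : x.toFun m = y.toFun m
    · rw [hxy]
      split_ifs
      · exact h.isometry.dist_eq x y
      · rfl
    · rw [dist_eq_of_toFun_ne hm hxy]
      refine dist_eq_of_toFun_ne hm ?_
      split_ifs <;> simpa [hh] using hxy

theorem restrictBalls_apply_of_mem (hm : ∀ l : Λ, radius l ≤ radius m) (h : UrysohnIsom Λ)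
    (hh : ∀ x, (h x).toFun m = x.toFun m) {F : Set ℤ} {x : UrysohnSpace Λ} (hx : x.toFun m ∈ F) :
    restrictBalls hm h hh F x = h x := if_pos hx

theorem restrictBalls_apply_of_not_mem (hm : ∀ l : Λ, radius l ≤ radius m) (h : UrysohnIsom Λ)
    (hh : ∀ x, (h x).toFun m = x.toFun m) {F : Set ℤ} {x : UrysohnSpace Λ} (hx : x.toFun m ∉ F) :
    restrictBalls hm h hh F x = x := if_neg hx

variable {H : Type*} [NormedAddCommGroup H] [InnerProductSpace ℂ H]

/-- If the spectrum has a maximal element, then a vector fixed by the permutations of the maximal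
proper balls is fixed by the whole group. -/
theorem fixed_of_permAt_fixed (hm : ∀ l : Λ, radius l ≤ radius m) (ρ : UnitaryRep (UrysohnIsom Λ) H)
    {v : H} (hv : ∀ σ, ρ.toHom (permAt m σ) v = v) (g : UrysohnIsom Λ) : ρ.toHom g v = v := by
  -- Conjugation by large shifts moves the balls in `F` away from any given point, so the conjugates
  -- tend to `1`; as the shifts fix `v`, its displacement stays constant and must be zero.
  have hfin : ∀ (h : UrysohnIsom Λ) (hh : ∀ x, (h x).toFun m = x.toFun m) (F : Finset ℤ),
      ρ.toHom (restrictBalls hm h hh F) v = v := by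
    intro h hh F
    let s : ℕ → UrysohnIsom Λ := fun n => permAt m (Equiv.addRight (n : ℤ))
    have hs : ∀ n, ρ.toHom (s n) v = v := fun n => hv _
    have hs' : ∀ n, ρ.toHom (s n)⁻¹ v = v := fun n => by
      conv_lhs => rw [← hs n]
      rw [← hom_mul_apply, inv_mul_cancel, map_one]
      rfl
    have hlim : Tendsto (fun n => s n * restrictBalls hm h hh F * (s n)⁻¹) atTop (𝓝 1) := by
      refine tendsto_of_eventually_eq fun x => ?_
      have hcoord : ∀ n, ((s n)⁻¹ x).toFun m = x.toFun m - n := fun n => by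
        have h1 : (s n ((s n)⁻¹ x)).toFun m = ((s n)⁻¹ x).toFun m + n := mapAt_toFun_self _ _ _
        rw [apply_inv_self] at h1
        linarith
      have hinj : Function.Injective fun n : ℕ => x.toFun m - (n : ℤ) := fun a b hab => by
        simpa using hab
      have hev : ∀ᶠ n : ℕ in atTop, x.toFun m - (n : ℤ) ∉ F := by
        rw [← Nat.cofinite_eq_atTop]
        exact hinj.tendsto_cofinite.eventually F.finite_toSet.compl_mem_cofinite
      filter_upwards [hev] with n hn
      rw [mul_apply, mul_apply, restrictBalls_apply_of_not_mem, apply_inv_self]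
      · rfl
      · rw [hcoord]
        exact_mod_cast hn
    have h1 : Tendsto (fun n => ‖ρ.toHom (s n * restrictBalls hm h hh F * (s n)⁻¹) v - v‖) atTop
        (𝓝 0) := by
      have := (((ρ.continuous_apply v).tendsto 1).comp hlim).sub_const v |>.norm
      simpa using this
    have h2 : ∀ n, ‖ρ.toHom (s n * restrictBalls hm h hh F * (s n)⁻¹) v - v‖ =
        ‖ρ.toHom (restrictBalls hm h hh F) v - v‖ := by
      intro n
      have h3 : ρ.toHom (s n) (ρ.toHom (restrictBalls hm h hh F) v) - v =
          ρ.toHom (s n) (ρ.toHom (restrictBalls hm h hh F) v - v) := by rw [map_sub, hs]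
      rw [hom_mul_apply, hs', hom_mul_apply, h3, LinearIsometryEquiv.norm_map]
    simp only [h2] at h1
    exact sub_eq_zero.1 (norm_eq_zero.1 (tendsto_nhds_unique tendsto_const_nhds h1))
  obtain ⟨σ, hσ⟩ := exists_perm_toFun hm g
  -- After removing the permutation of the balls, `h` preserves each ball and is the limit of its
  -- restrictions to finitely many of them.
  set h : UrysohnIsom Λ := permAt m σ⁻¹ * g with hdef
  have hh : ∀ x, (h x).toFun m = x.toFun m := fun x => by
    rw [hdef, mul_apply, permAt_apply, mapAt_toFun_self, hσ]
    exact σ.symm_apply_apply _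
  have hlim : Tendsto (fun F : Finset ℤ => restrictBalls hm h hh F) atTop (𝓝 h) := by
    refine tendsto_of_eventually_eq fun x => ?_
    filter_upwards [eventually_ge_atTop {x.toFun m}] with F hF
    exact restrictBalls_apply_of_mem hm h hh (by simpa using hF)
  have hfix : ρ.toHom h v = v := by
    have h1 := ((ρ.continuous_apply v).tendsto h).comp hlim
    refine tendsto_nhds_unique h1 (tendsto_const_nhds.congr fun F => ?_)
    exact (hfin h hh F).symm
  have hg : g = permAt m σ * h := by
    rw [hdef, ← mul_assoc, ← map_mul, mul_inv_cancel, map_one, one_mul]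
  rw [hg, hom_mul_apply, hfix, hv]

end MaximalRadius

/-- If the spectrum has a maximal element, then the isometry group has property (T). -/
theorem hasPropertyT_of_isGreatest {μ : Set.Ioi (0 : ℝ)} (hμ : IsGreatest Λ μ) :
    HasPropertyT (UrysohnIsom Λ) := by
  intro H _ _ _ _ ρ hρ
  by_contra hno
  let m : Λ := ⟨μ, hμ.1⟩
  have hm : ∀ l : Λ, radius l ≤ radius m := fun l => hμ.2 l.2
  -- Any bijection serves: it only relabels the balls by elements of the free group.
  obtain ⟨e⟩ : Nonempty (FreeGroup Bool ≃ ℤ) := nonempty_equiv_of_countable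
  let j : Equiv.Perm (FreeGroup Bool) →* UrysohnIsom Λ := (permAt m).comp e.permCongrHom.toMonoidHom
  have hj : ∀ σ, j (e.permCongrHom.symm σ) = permAt m σ := fun σ =>
    congrArg (permAt m) (e.permCongrHom.apply_symm_apply σ)
  have hgap : ∀ v, ‖∑ p, ρ.toHom (j (letterPerm p)) v‖ ≤ 7 / 2 * ‖v‖ := by
    refine norm_sum_letterPerm_le (ρ.toHom.comp j) (fun v ε hε => ?_) (fun v hv => ?_)
    · have hS : {g : UrysohnIsom Λ | ‖ρ.toHom g v - v‖ ≤ ε} ∈ 𝓝 1 := by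
        have h1 : Tendsto (fun g => ‖ρ.toHom g v - v‖) (𝓝 1) (𝓝 0) := by
          have := (((ρ.continuous_apply v).tendsto 1).sub_const v).norm
          simpa using this
        exact h1.eventually (Iic_mem_nhds hε)
      obtain ⟨F, hF⟩ := exists_finset_fixing_subset hS
      classical
      refine ⟨F.image fun x => e.symm (x.toFun m), fun σ hσ => hF (j σ) fun x hx => ?_⟩
      refine mapAt_eq_self ?_
      change e (σ (e.symm (x.toFun m))) = _
      rw [hσ _ (Finset.mem_image_of_mem _ hx), e.apply_symm_apply]
    · by_contra hv0
      refine hno ⟨v, hv0, fixed_of_permAt_fixed hm ρ fun σ => ?_⟩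
      rw [← hj]
      exact hv _
  -- The error `1 / 32` is small enough because `4 * (1 / 32) + 7 / 2 * (33 / 32) < 4`.
  obtain ⟨n, η, hη⟩ := hρ 1 (insert 1 (Set.range fun p => j (letterPerm p)))
    ((Set.finite_range _).insert 1).isCompact (1 / 32) (by norm_num)
  have hone : ∀ g : UrysohnIsom Λ,
      inner ℂ (1 : ℂ) ((UnitaryRep.trivial (UrysohnIsom Λ)).toHom g 1) = 1 := fun g => by
    simp [UnitaryRep.trivial]
  simp only [hone] at hη
  have h1 : ∑ i, ‖η i‖ ^ 2 ≤ 33 / 32 := by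
    have h2 := hη 1 (Set.mem_insert _ _)
    have h3 : ∑ i, inner ℂ (η i) (ρ.toHom 1 (η i)) = ((∑ i, ‖η i‖ ^ 2 : ℝ) : ℂ) := by
      push_cast
      refine Finset.sum_congr rfl fun i _ => ?_
      rw [map_one]
      exact inner_self_eq_norm_sq_to_K _
    rw [h3] at h2
    have h4 : ‖(((1 - ∑ i, ‖η i‖ ^ 2 : ℝ)) : ℂ)‖ < 1 / 32 := by simpa using h2
    rw [Complex.norm_real, Real.norm_eq_abs] at h4
    linarith [(abs_lt.1 h4).1]
  have h5 : ‖(4 : ℂ) - ∑ i, inner ℂ (η i) (∑ p, ρ.toHom (j (letterPerm p)) (η i))‖ ≤ 4 * (1 / 32) := by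
    have h6 : (4 : ℂ) - ∑ i, inner ℂ (η i) (∑ p, ρ.toHom (j (letterPerm p)) (η i)) =
        ∑ p : Bool × Bool, (1 - ∑ i, inner ℂ (η i) (ρ.toHom (j (letterPerm p)) (η i))) := by
      rw [Finset.sum_sub_distrib, Finset.sum_comm]
      simp only [inner_sum]
      simp
    rw [h6]
    refine (norm_sum_le _ _).trans ((Finset.sum_le_card_nsmul _ _ (1 / 32) fun p _ => ?_).trans ?_)
    · exact (hη _ (Set.mem_insert_of_mem _ ⟨p, rfl⟩)).le
    · simp
  have h7 : ‖∑ i, inner ℂ (η i) (∑ p, ρ.toHom (j (letterPerm p)) (η i))‖ ≤ 7 / 2 * (33 / 32) := by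
    calc _ ≤ ∑ i, ‖inner ℂ (η i) (∑ p, ρ.toHom (j (letterPerm p)) (η i))‖ := norm_sum_le _ _
      _ ≤ ∑ i, 7 / 2 * ‖η i‖ ^ 2 := Finset.sum_le_sum fun i _ => by
          refine (norm_inner_le_norm _ _).trans ?_
          have := mul_le_mul_of_nonneg_left (hgap (η i)) (norm_nonneg (η i))
          linarith
      _ = 7 / 2 * ∑ i, ‖η i‖ ^ 2 := by rw [Finset.mul_sum]
      _ ≤ _ := by gcongr
  have h8 : (4 : ℝ) ≤ ‖(4 : ℂ) - ∑ i, inner ℂ (η i) (∑ p, ρ.toHom (j (letterPerm p)) (η i))‖ +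
      ‖∑ i, inner ℂ (η i) (∑ p, ρ.toHom (j (letterPerm p)) (η i))‖ := by
    have := norm_add_le ((4 : ℂ) - ∑ i, inner ℂ (η i) (∑ p, ρ.toHom (j (letterPerm p)) (η i)))
      (∑ i, inner ℂ (η i) (∑ p, ρ.toHom (j (letterPerm p)) (η i)))
    rw [sub_add_cancel] at this
    simpa using this
  linarith

end UrysohnIsom

section Separability

variable {𝕜 H : Type*} [RCLike 𝕜] [NormedAddCommGroup H] [InnerProductSpace 𝕜 H]

theorem separableSpace_of_dense_span {s : Set H} (hs : TopologicalSpace.IsSeparable s)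
    (hd : Dense (Submodule.span 𝕜 s : Set H)) : TopologicalSpace.SeparableSpace H := by
  have h := (hs.span (R := 𝕜)).closure
  rw [hd.closure_eq] at h
  exact TopologicalSpace.isSeparable_univ_iff.1 h

end Separability

/-! ### Failure of property (T): the action on balls. -/

namespace UrysohnIsom

open UrysohnSpace

variable {Λ : Set (Set.Ioi (0 : ℝ))}

/-- The closed balls whose radius belongs to the spectrum. -/
def Balls (Λ : Set (Set.Ioi (0 : ℝ))) : Type :=
  {s : Set (UrysohnSpace Λ) // ∃ (x : UrysohnSpace Λ) (l : Λ), s = Metric.closedBall x (radius l)}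

theorem countable_balls (hΛ : Λ.Countable) : Countable (Balls Λ) := by
  have : Countable Λ := hΛ.to_subtype
  have := separableSpace hΛ
  obtain ⟨D, hDc, hD⟩ := TopologicalSpace.exists_countable_dense (UrysohnSpace Λ)
  have : Countable D := hDc.to_subtype
  let f : D × Λ → Balls Λ := fun p => ⟨Metric.closedBall p.1 (radius p.2), _, _, rfl⟩
  refine Function.Surjective.countable (f := f) ?_
  rintro ⟨s, x, l, rfl⟩
  obtain ⟨d, hd, hdD⟩ := Metric.dense_iff.1 hD x (radius l) (radius_pos l)
  exact ⟨(⟨d, hdD⟩, l), Subtype.ext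
    (IsUltrametricDist.closedBall_eq_of_mem (Metric.ball_subset_closedBall hd)).symm⟩

/-- The action on the set of balls. -/
def ballsHom (Λ : Set (Set.Ioi (0 : ℝ))) : UrysohnIsom Λ →* Equiv.Perm (Balls Λ) where
  toFun g :=
    { toFun := fun s => ⟨g '' s.1, by
        obtain ⟨s, x, l, rfl⟩ := s
        exact ⟨g x, l, g.image_closedBall x _⟩⟩
      invFun := fun s => ⟨g.symm '' s.1, by
        obtain ⟨s, x, l, rfl⟩ := s
        exact ⟨g.symm x, l, g.symm.image_closedBall x _⟩⟩
      left_inv := fun s => Subtype.ext (g.toEquiv.symm_image_image s.1)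
      right_inv := fun s => Subtype.ext (g.toEquiv.image_symm_image s.1) }
  map_one' := Equiv.ext fun s => Subtype.ext (Set.image_id s.1)
  map_mul' g h := Equiv.ext fun s => Subtype.ext (Set.image_comp g h s.1)

/-- The ball of radius `l` centered at `x`. -/
noncomputable def ballAt (x : UrysohnSpace Λ) (l : Λ) : Balls Λ :=
  ⟨Metric.closedBall x (radius l), x, l, rfl⟩

theorem ballAt_eq_iff {x y : UrysohnSpace Λ} {l : Λ} :
    ballAt x l = ballAt y l ↔ dist x y ≤ radius l := by
  constructor
  · intro h
    have h1 : Metric.closedBall x (radius l) = Metric.closedBall y (radius l) :=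
      congrArg Subtype.val h
    have h2 : x ∈ Metric.closedBall y (radius l) :=
      h1 ▸ Metric.mem_closedBall_self (radius_pos l).le
    exact h2
  · intro h
    exact Subtype.ext (IsUltrametricDist.closedBall_eq_of_mem (x := y) (y := x) h).symm

theorem ballsHom_ballAt (g : UrysohnIsom Λ) (x : UrysohnSpace Λ) (l : Λ) :
    ballsHom Λ g (ballAt x l) = ballAt (g x) l :=
  Subtype.ext (g.image_closedBall x _)

theorem exists_eq_ballAt (s : Balls Λ) : ∃ x l, s = ballAt x l := by
  obtain ⟨s, x, l, rfl⟩ := s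
  exact ⟨x, l, rfl⟩

/-- Balls are open, so their stabilizers are open and orbit maps are locally constant; hence no
condition on `f`. -/
theorem continuous_comp_ballsHom {E : Type*} [TopologicalSpace E] (f : Balls Λ → E) (s : Balls Λ) :
    Continuous fun g => f (ballsHom Λ g s) := by
  obtain ⟨x, l, rfl⟩ := exists_eq_ballAt s
  refine continuous_iff_continuousAt.2 fun g₀ => ?_
  refine tendsto_const_nhds.congr' ?_
  have h := (continuous_eval x).tendsto g₀ (Metric.closedBall_mem_nhds _ (radius_pos l))
  filter_upwards [h] with g hg
  rw [ballsHom_ballAt, ballsHom_ballAt]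
  congr 1
  exact (ballAt_eq_iff.2 hg).symm

theorem exists_lt_radius (hno : ¬ ∃ μ, IsGreatest Λ μ) (l : Λ) : ∃ l' : Λ, radius l < radius l' := by
  by_contra! h
  exact hno ⟨l, l.2, fun μ hμ => h ⟨μ, hμ⟩⟩

/-- Every orbit of balls is infinite if the spectrum has no maximal element. -/
theorem exists_injective_orbit (hno : ¬ ∃ μ, IsGreatest Λ μ) (s : Balls Λ) :
    ∃ g : ℤ → UrysohnIsom Λ, Function.Injective fun k => ballsHom Λ (g k) s := by
  obtain ⟨x, l, rfl⟩ := exists_eq_ballAt s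
  -- Translates that differ at a coordinate `l'` beyond the radius send the ball to distinct balls.
  obtain ⟨l', hl'⟩ := exists_lt_radius hno l
  refine ⟨fun k => translate 0 (single l' k), fun a b hab => ?_⟩
  simp only [ballsHom_ballAt, ballAt_eq_iff] at hab
  have := eq_of_dist_lt (hab.trans_lt hl')
  simpa [translate_toFun] using this

/-- A compact set of isometries preserves some ball. -/
theorem exists_ball_fixed_of_isCompact (hne : Λ.Nonempty) {Q : Set (UrysohnIsom Λ)} (hQ : IsCompact Q) : ∃ s, ∀ g ∈ Q, ballsHom Λ g s = s := by
  obtain ⟨l₀, hl₀⟩ := hne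
  rcases Q.eq_empty_or_nonempty with rfl | hQne
  · exact ⟨ballAt 0 ⟨l₀, hl₀⟩, by simp⟩
  -- Compactness bounds the displacement of `0`; a ball about `0` whose radius exceeds or equals
  -- this bound is preserved.
  obtain ⟨g₀, -, hg₀⟩ := hQ.exists_isMaxOn hQne
    ((continuous_eval (0 : UrysohnSpace Λ)).dist continuous_const).continuousOn (f := fun g =>
      dist (g (0 : UrysohnSpace Λ)) 0)
  obtain ⟨l, hl⟩ : ∃ l : Λ, dist (g₀ 0) 0 ≤ radius l := by
    by_cases h : g₀ 0 = 0
    · exact ⟨⟨l₀, hl₀⟩, by rw [h, dist_self]; exact (radius_pos _).le⟩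
    · obtain ⟨l, -, hl⟩ := exists_radius_eq_dist h
      exact ⟨l, hl.ge⟩
  refine ⟨ballAt 0 l, fun g hg => ?_⟩
  rw [ballsHom_ballAt, ballAt_eq_iff]
  exact (hg₀ hg).trans hl

/-- If the spectrum has no maximal element, then the isometry group does not have property (T). -/
theorem not_hasPropertyT (hΛ : Λ.Countable) (hne : Λ.Nonempty) (hno : ¬ ∃ μ, IsGreatest Λ μ) :
    ¬ HasPropertyT (UrysohnIsom Λ) := by
  intro hT
  have := countable_balls hΛ
  let b : HilbertBasis (Balls Λ) ℂ (lp (fun _ : Balls Λ => ℂ) 2) :=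
    ⟨LinearIsometryEquiv.refl ℂ _⟩
  have hd : Dense (Submodule.span ℂ (Set.range b) : Set (lp (fun _ : Balls Λ => ℂ) 2)) :=
    Submodule.dense_iff_topologicalClosure_eq_top.2 b.dense_span
  have hsep : TopologicalSpace.SeparableSpace (lp (fun _ : Balls Λ => ℂ) 2) :=
    separableSpace_of_dense_span (Set.countable_range b).isSeparable hd
  have hb := b.orthonormal
  classical
  obtain ⟨L, hL⟩ := exists_unitary_hom_of_inner_eq hd (ballsHom Λ) fun g s t => by
    simp only [orthonormal_iff_ite.1 hb, EmbeddingLike.apply_eq_iff_eq]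
  let ρ : UnitaryRep (UrysohnIsom Λ) (lp (fun _ : Balls Λ => ℂ) 2) :=
    ⟨L, continuous_unitary_apply_of_dense hd (fun g => L g) fun s => by
      simp only [hL]
      exact continuous_comp_ballsHom b s⟩
  obtain ⟨v, hv0, hv⟩ := hT _ ρ fun ξ Q hQ ε hε => by
    obtain ⟨s, hs⟩ := exists_ball_fixed_of_isCompact hne hQ
    -- A single coefficient agrees exactly on `Q`: that of the basis vector of a preserved ball.
    refine ⟨1, fun _ => ξ • b s, fun g hg => ?_⟩
    have h1 : ρ.toHom g (ξ • b s) = ξ • b s := by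
      rw [map_smul]
      exact congrArg (ξ • ·) ((hL g s).trans (by rw [hs g hg]))
    have h2 : inner ℂ (b s) (b s) = (1 : ℂ) := by
      rw [orthonormal_iff_ite.1 hb, if_pos rfl]
    have h3 : (UnitaryRep.trivial (UrysohnIsom Λ)).toHom g ξ = ξ := rfl
    simp only [h1, h3, Finset.univ_unique, Finset.sum_singleton, inner_smul_left, inner_smul_right,
      h2]
    simpa [Complex.mul_conj'] using hε
  have hzero : ∀ s, inner ℂ (b s) v = 0 := by
    intro s
    obtain ⟨g, hg⟩ := exists_injective_orbit hno s
    have h1 : Summable fun t => ‖inner ℂ (b t) v‖ ^ 2 := hb.inner_products_summable v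
    have h2 := h1.comp_injective hg
    -- An invariant vector has constant coefficients on an orbit; the orbit is infinite, so square
    -- summability makes them vanish.
    have h3 : ∀ k, inner ℂ (b (ballsHom Λ (g k) s)) v = inner ℂ (b s) v := fun k => by
      rw [← hL]
      conv_lhs => rw [← hv (g k)]
      exact (L (g k)).inner_map_map _ _
    have h4 : Summable fun _ : ℤ => ‖inner ℂ (b s) v‖ ^ 2 := by
      refine h2.congr fun k => ?_
      simp only [Function.comp_apply, h3]
    simpa using (summable_const_iff _).1 h4
  refine hv0 (hd.eq_zero_of_inner_right ℂ fun w hw => ?_)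
  induction hw using Submodule.span_induction with
  | mem w hw => obtain ⟨s, rfl⟩ := hw; exact hzero s
  | zero => exact inner_zero_left _
  | add a c _ _ ha hc => rw [inner_add_left, ha, hc, add_zero]
  | smul r a _ ha => rw [inner_smul_left, ha, mul_zero]

end UrysohnIsom

/-! ### Rescaled embedding and affine action without fixed points. -/

section Rescaling

/-- The half-open interval `[0, sup Λ)` is order isomorphic to `[0, ∞)`, if `Λ` has no maximal
element. -/
theorem exists_bijOn_rescaling {Λ : Set (Set.Ioi (0 : ℝ))} (hne : Λ.Nonempty)
    (hno : ¬ ∃ μ, IsGreatest Λ μ) :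
    ∃ κ : ℝ → ℝ, StrictMonoOn κ {t : ℝ | 0 ≤ t ∧ ∃ l ∈ Λ, t < (l : ℝ)} ∧
      Set.BijOn κ {t : ℝ | 0 ≤ t ∧ ∃ l ∈ Λ, t < (l : ℝ)} (Set.Ici 0) ∧
      (¬ BddAbove ((fun l : Set.Ioi (0 : ℝ) => (l : ℝ)) '' Λ) → ∀ t, κ t = t) := by
  by_cases hb : BddAbove ((fun l : Set.Ioi (0 : ℝ) => (l : ℝ)) '' Λ)
  · set s := sSup ((fun l : Set.Ioi (0 : ℝ) => (l : ℝ)) '' Λ) with hs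
    have hlt : ∀ l ∈ Λ, (l : ℝ) < s := by
      intro l hl
      refine lt_of_le_of_ne (le_csSup hb ⟨l, hl, rfl⟩) fun e => hno ⟨l, hl, fun m hm => ?_⟩
      have h1 : (m : ℝ) ≤ s := le_csSup hb ⟨m, hm, rfl⟩
      rw [← e] at h1
      exact h1
    have hS : {t : ℝ | 0 ≤ t ∧ ∃ l ∈ Λ, t < (l : ℝ)} = Set.Ico 0 s := by
      ext t
      refine and_congr_right fun _ => ⟨fun ⟨l, hl, h⟩ => h.trans (hlt l hl), fun h => ?_⟩
      obtain ⟨_, ⟨l, hl, rfl⟩, h2⟩ := exists_lt_of_lt_csSup (hne.image _) h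
      exact ⟨l, hl, h2⟩
    have hs0 : 0 < s := hne.elim fun l hl => lt_trans l.2 (hlt l hl)
    have hmono : StrictMonoOn (fun t : ℝ => t / (s - t)) (Set.Ico 0 s) := by
      intro a ha b hb hab
      change a / (s - a) < b / (s - b)
      rw [div_lt_div_iff₀ (sub_pos.2 ha.2) (sub_pos.2 hb.2)]
      nlinarith
    refine ⟨fun t => t / (s - t), ?_, ?_, fun h => absurd hb h⟩
    · rw [hS]
      exact hmono
    · rw [hS]
      refine ⟨fun t ht => div_nonneg ht.1 (sub_pos.2 ht.2).le, hmono.injOn, fun y hy => ?_⟩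
      have hy0 : (0 : ℝ) ≤ y := hy
      have hy1 : 0 < 1 + y := by linarith
      refine ⟨s * y / (1 + y), ⟨by positivity, ?_⟩, ?_⟩
      · rw [div_lt_iff₀ hy1]
        nlinarith
      · change s * y / (1 + y) / (s - s * y / (1 + y)) = y
        have : s - s * y / (1 + y) = s / (1 + y) := by field_simp; ring
        rw [this]
        field_simp
  · have hS : {t : ℝ | 0 ≤ t ∧ ∃ l ∈ Λ, t < (l : ℝ)} = Set.Ici 0 := by
      ext t
      refine ⟨fun h => h.1, fun h => ⟨h, ?_⟩⟩
      obtain ⟨_, ⟨l, hl, rfl⟩, h2⟩ := not_bddAbove_iff.1 hb t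
      exact ⟨l, hl, h2⟩
    refine ⟨id, strictMonoOn_id, ?_, fun _ _ => rfl⟩
    rw [hS]
    exact Set.bijOn_id _

end Rescaling

/-- It upgrades density of the linear span of the image of `ψ`, which contains `0`, to density of
its affine span. -/
theorem span_subset_affineSpan_of_zero_mem {H : Type*} [NormedAddCommGroup H]
    [InnerProductSpace ℝ H] {s : Set H} (h0 : (0 : H) ∈ s) :
    (Submodule.span ℝ s : Set H) ⊆ (affineSpan ℝ s : Set H) := by
  intro v hv
  rw [SetLike.mem_coe, ← AffineSubspace.vsub_right_mem_direction_iff_mem (mem_affineSpan ℝ h0),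
    direction_affineSpan, vsub_eq_sub, sub_zero]
  refine Submodule.span_le.2 (fun x hx => ?_) hv
  simpa using vsub_mem_vectorSpan ℝ hx h0

open UrysohnSpace UrysohnIsom in
/-- If the spectrum has no maximal element, then the isometry group has a continuous affine
isometric action without fixed points that extends its action on an embedded copy of the space. -/
theorem exists_affine_action_of_no_greatest (Λ : Set (Set.Ioi (0 : ℝ))) (hcount : Λ.Countable)
    (hne : Λ.Nonempty) (hno : ¬ ∃ μ, IsGreatest Λ μ) :
    ∃ (κ : ℝ → ℝ) (H : Type) (_ : NormedAddCommGroup H) (_ : InnerProductSpace ℝ H)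
      (_ : CompleteSpace H) (_ : TopologicalSpace.SeparableSpace H)
      (ψ : UrysohnSpace Λ → H) (α : AffineIsometricAction (UrysohnIsom Λ) H),
      StrictMonoOn κ {t : ℝ | 0 ≤ t ∧ ∃ l ∈ Λ, t < (l : ℝ)} ∧
      Set.BijOn κ {t : ℝ | 0 ≤ t ∧ ∃ l ∈ Λ, t < (l : ℝ)} (Set.Ici 0) ∧
      (∀ x y, dist (ψ x) (ψ y) = κ (dist x y)) ∧
      (¬ BddAbove ((fun l : Set.Ioi (0 : ℝ) => (l : ℝ)) '' Λ) → Isometry ψ) ∧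
      Dense ((affineSpan ℝ (Set.range ψ) : AffineSubspace ℝ H) : Set H) ∧
      (∀ g x, α.toHom g (ψ x) = ψ (g x)) ∧
      ¬ ∃ p : H, ∀ g, α.toHom g p = p := by
  obtain ⟨κ, hmono, hbij, hid⟩ := exists_bijOn_rescaling hne hno
  set S : Set ℝ := {t : ℝ | 0 ≤ t ∧ ∃ l ∈ Λ, t < (l : ℝ)} with hS
  have h0S : (0 : ℝ) ∈ S := ⟨le_rfl, hne.imp fun l hl => ⟨hl, l.2⟩⟩
  have hdS : ∀ x y : UrysohnSpace Λ, dist x y ∈ S := by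
    intro x y
    by_cases h : x = y
    · rwa [h, dist_self]
    · obtain ⟨l, -, hl⟩ := exists_radius_eq_dist h
      obtain ⟨l', hl'⟩ := exists_lt_radius hno l
      exact ⟨dist_nonneg, l', l'.2, hl ▸ hl'⟩
  have hnn : ∀ t ∈ S, 0 ≤ κ t := fun t ht => hbij.mapsTo ht
  have hκ0 : κ 0 = 0 := by
    obtain ⟨t, ht, h⟩ := hbij.surjOn (Set.mem_Ici.2 le_rfl : (0 : ℝ) ∈ Set.Ici 0)
    exact le_antisymm (h ▸ hmono.monotoneOn h0S ht ht.1) (hnn 0 h0S)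
  -- Squaring compensates the square root in the embedding, and monotonicity of `κ` preserves the
  -- ultrametric inequality.
  obtain ⟨H, i1, i2, i3, ψ, hψ, hψ0, hd⟩ := exists_hilbert_embedding_of_ultrametric
    (fun x y : UrysohnSpace Λ => κ (dist x y) ^ 2) (fun x => by simp [hκ0])
    (fun x y => by rw [dist_comm]) (fun x y z => by
      have hle : ∀ s ∈ S, ∀ t ∈ S, s ≤ t → κ s ^ 2 ≤ κ t ^ 2 := fun s hs t ht h =>
        pow_le_pow_left₀ (hnn s hs) (hmono.monotoneOn hs ht h) 2
      rcases le_max_iff.1 (dist_triangle_max x y z) with h | h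
      · exact le_max_of_le_left (hle _ (hdS _ _) _ (hdS _ _) h)
      · exact le_max_of_le_right (hle _ (hdS _ _) _ (hdS _ _) h)) 0
  have hdist : ∀ x y, dist (ψ x) (ψ y) = κ (dist x y) := fun x y => by
    rw [dist_eq_norm]
    exact (pow_left_inj₀ (norm_nonneg _) (hnn _ (hdS x y)) two_ne_zero).1 (hψ x y)
  have hψc : Continuous ψ := by
    refine Metric.continuous_iff.2 fun x ε hε => ?_
    obtain ⟨δ, hδ, h⟩ := hbij.surjOn (Set.mem_Ici.2 hε.le)
    have hδ0 : 0 < δ := lt_of_le_of_ne hδ.1 fun e => hε.ne' (by rw [← h, ← e, hκ0])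
    exact ⟨δ, hδ0, fun y hy => by rw [hdist, ← h]; exact hmono (hdS _ _) hδ hy⟩
  have hsepU := separableSpace hcount
  have hsep : TopologicalSpace.SeparableSpace H :=
    separableSpace_of_dense_span (TopologicalSpace.isSeparable_range hψc) hd
  obtain ⟨α, hα⟩ := exists_affineIsometricAction (permHom Λ) hψ0 hd
    (fun g x y => by
      rw [← dist_eq_norm, ← dist_eq_norm, hdist, hdist, permHom_apply, permHom_apply,
        g.isometry.dist_eq])
    fun x => hψc.comp (continuous_eval x)
  refine ⟨κ, H, i1, i2, i3, hsep, ψ, α, hmono, hbij, hdist,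
    fun hb => Isometry.of_dist_eq fun x y => by rw [hdist, hid hb],
    hd.mono (span_subset_affineSpan_of_zero_mem ⟨0, hψ0⟩), hα, ?_⟩
  rintro ⟨p, hp⟩
  -- Translations are transitive, so a fixed point is equidistant from the whole image.
  have hsphere : ∀ x, dist (ψ x) p = dist (ψ 0) p := by
    intro x
    have h1 : α.toHom (translate 0 x) (ψ 0) = ψ x := by
      rw [hα, permHom_apply, translate_apply_self]
    conv_lhs => rw [← h1, ← hp (translate 0 x)]
    exact (α.toHom (translate 0 x)).dist_map _ _
  -- The value `κ t` exceeds the diameter of that sphere, and some `l > t` in `Λ` is a distance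
  -- between two points.
  obtain ⟨t, ht, h⟩ := hbij.surjOn
    (Set.mem_Ici.2 (by positivity : (0 : ℝ) ≤ 2 * dist (ψ 0) p + 1))
  obtain ⟨l, hl, htl⟩ := ht.2
  let m : Λ := ⟨l, hl⟩
  have h2 : dist (ψ (single m 1)) (ψ 0) = κ l := by
    rw [hdist, dist_single_zero m one_ne_zero]
  have h3 : κ t < κ l := by
    refine hmono ht ?_ htl
    have := hdS (single m 1) 0
    rwa [dist_single_zero m one_ne_zero] at this
  have h4 := dist_triangle_right (ψ (single m 1)) (ψ 0) p
  rw [hsphere] at h4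
  linarith

theorem mainTheorem6 (Λ : Set (Set.Ioi (0 : ℝ))) (hcount : Λ.Countable) (hne : Λ.Nonempty) :
    (HasPropertyT (UrysohnIsom Λ) ↔ ∃ μ, IsGreatest Λ μ) ∧
    ((¬ ∃ μ, IsGreatest Λ μ) →
      ∃ (κ : ℝ → ℝ) (H : Type) (_ : NormedAddCommGroup H) (_ : InnerProductSpace ℝ H)
        (_ : CompleteSpace H) (_ : TopologicalSpace.SeparableSpace H)
        (ψ : UrysohnSpace Λ → H) (α : AffineIsometricAction (UrysohnIsom Λ) H),
        -- `κ` is an increasing bijection of `[0, sup Λ)` onto `[0, ∞)`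
        StrictMonoOn κ {t : ℝ | 0 ≤ t ∧ ∃ l ∈ Λ, t < (l : ℝ)} ∧
        Set.BijOn κ {t : ℝ | 0 ≤ t ∧ ∃ l ∈ Λ, t < (l : ℝ)} (Set.Ici 0) ∧
        (∀ x y, dist (ψ x) (ψ y) = κ (dist x y)) ∧
        (¬ BddAbove ((fun l : Set.Ioi (0 : ℝ) => (l : ℝ)) '' Λ) → Isometry ψ) ∧
        Dense ((affineSpan ℝ (Set.range ψ) : AffineSubspace ℝ H) : Set H) ∧
        (∀ g x, α.toHom g (ψ x) = ψ (g x)) ∧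
        ¬ ∃ p : H, ∀ g, α.toHom g p = p) :=
  ⟨⟨fun hT => by_contra fun hno => UrysohnIsom.not_hasPropertyT hcount hne hno hT,
    fun ⟨_, hμ⟩ => UrysohnIsom.hasPropertyT_of_isGreatest hμ⟩,
    exists_affine_action_of_no_greatest Λ hcount hne⟩
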